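/- Let $\Omega\subset\mathbb C$ be a Borel set, $\lambda$ Lebesgue measure, and let $M_f$ denote multiplication by $f\in L^\infty(\Omega,\lambda)$ on the Hilbert space $L^2(\Omega,\lambda)$ of complex-valued functions. Put $Df(s,t)=\frac{f(s)-f(t)}{s-t}$ for $s\ne t$, and $$\Lambda(\Omega)=\{f\in L^\infty(\Omega,\lambda) : Df\in L^\infty(\Omega\times\Omega,\lambda\otimes\lambda)\}.$$ For a bounded operator $T$ on $L^2(\Omega,\lambda)$ let $$L(T)=\sup\{|[M_f,T]|_2 : f\in\Lambda(\Omega),\ \|Df\|_\infty\le 1\}\in[0,\infty],$$ where $|\cdot|_2$ is the Hilbert--Schmidt norm ($=\infty$ for operators that are not Hilbert--Schmidt). Let $E\Lambda(\Omega)$ be the algebra of all bounded operators $T$ on $L^2(\Omega,\lambda)$ with $L(T)<\infty$, and let $\mathcal K\Lambda(\Omega)$ be the ideal of compact operators in $E\Lambda(\Omega)$, with the norm $|||T|||=\|T\|+L(T)$. Let $\mathcal M(\mathcal K\Lambda(\Omega))$ be the algebra of double centralizers of $\mathcal K\Lambda(\Omega)$, that is, of pairs $(T',T'')$ of $|||\cdot|||$-bounded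 linear maps $\mathcal K\Lambda(\Omega)\to\mathcal K\Lambda(\Omega)$ such that $T'(x)y=xT''(y)$ for all $x,y\in\mathcal K\Lambda(\Omega)$, with product $(S',S'')(T',T'')=(T'\circ S',\,S''\circ T'')$. Then $\mathcal M(\mathcal K\Lambda(\Omega))=E\Lambda(\Omega)$. That is, $T\mapsto(x\mapsto xT,\ x\mapsto Tx)$ is an isomorphism of complex algebras from $E\Lambda(\Omega)$ onto $\mathcal M(\mathcal K\Lambda(\Omega))$; in particular, for every $(T',T'')\in\mathcal M(\mathcal K\Lambda(\Omega))$ there is a unique $T\in E\Lambda(\Omega)$ such that $T'(x)=xT$ and $T''(x)=Tx$ for all $x\in\mathcal K\Lambda(\Omega)$. -/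

import Mathlib

open MeasureTheory
open scoped ENNReal MultiplierAlgebra

noncomputable section

section HilbertSchmidt

variable {H : Type*} [NormedAddCommGroup H] [InnerProductSpace ℂ H] [CompleteSpace H]

/-- An index set for an orthonormal basis of `H`. -/
def hsIndex (H : Type*) [NormedAddCommGroup H] [InnerProductSpace ℂ H] [CompleteSpace H] :
    Set H :=
  (exists_hilbertBasis ℂ H).choose

/-- Some orthonormal basis of `H`. -/
def hsBasis (H : Type*) [NormedAddCommGroup H] [InnerProductSpace ℂ H] [CompleteSpace H] :
    HilbertBasis (hsIndex H) ℂ H :=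
  (exists_hilbertBasis ℂ H).choose_spec.choose

/-- The Hilbert-Schmidt norm `|T|₂ = Tr(T*T)^{1/2} = (∑ ‖T eᵢ‖²)^{1/2}`, with value `∞` if `T` is
not a Hilbert-Schmidt operator. It does not depend on the orthonormal basis, see
`hsNorm_eq_of_basis`. -/
def hsNorm (T : H →L[ℂ] H) : ℝ≥0∞ :=
  (∑' i, ‖T (hsBasis H i)‖ₑ ^ (2 : ℝ)) ^ (1 / 2 : ℝ)

lemma enorm_sq_eq_tsum {ι : Type*} (b : HilbertBasis ι ℂ H) (x : H) :
    ‖x‖ₑ ^ (2 : ℝ) = ∑' i, ‖inner ℂ (b i) x‖ₑ ^ (2 : ℝ) := by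
  have h := b.hasSum_inner_mul_inner x x
  have h2 : HasSum (fun i => ‖inner ℂ (b i) x‖ ^ 2) (‖x‖ ^ 2) := by
    have h3 := Complex.reCLM.hasSum h
    convert! h3 using 1
    · funext i
      simp only [Complex.reCLM_apply]
      rw [← inner_conj_symm x (b i), ← Complex.normSq_eq_conj_mul_self, Complex.ofReal_re,
        Complex.normSq_eq_norm_sq]
    · simpa using (inner_self_eq_norm_sq (𝕜 := ℂ) x).symm
  have h4 := ENNReal.ofReal_tsum_of_nonneg (fun i => by positivity) h2.summable
  rw [h2.tsum_eq] at h4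
  simp only [ENNReal.rpow_two]
  rw [← ofReal_norm, ← ENNReal.ofReal_pow (norm_nonneg _), h4]
  refine tsum_congr fun i => ?_
  rw [← ofReal_norm, ← ENNReal.ofReal_pow (norm_nonneg _)]

lemma tsum_enorm_sq_adjoint {ι κ : Type*} (b : HilbertBasis ι ℂ H) (c : HilbertBasis κ ℂ H)
    (T : H →L[ℂ] H) :
    ∑' i, ‖T (b i)‖ₑ ^ (2 : ℝ) = ∑' j, ‖ContinuousLinearMap.adjoint T (c j)‖ₑ ^ (2 : ℝ) := by
  simp_rw [enorm_sq_eq_tsum c (T _), enorm_sq_eq_tsum b (ContinuousLinearMap.adjoint T _)]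
  rw [ENNReal.tsum_comm]
  refine tsum_congr fun j => tsum_congr fun i => ?_
  rw [ContinuousLinearMap.adjoint_inner_right, ← inner_conj_symm, ← ofReal_norm,
    ← ofReal_norm, RCLike.norm_conj]

/-- The Hilbert-Schmidt norm can be computed in any orthonormal basis. -/
theorem hsNorm_eq_of_basis {ι : Type*} (b : HilbertBasis ι ℂ H) (T : H →L[ℂ] H) :
    hsNorm T = (∑' i, ‖T (b i)‖ₑ ^ (2 : ℝ)) ^ (1 / 2 : ℝ) := by
  rw [hsNorm, tsum_enorm_sq_adjoint (hsBasis H) (hsBasis H), tsum_enorm_sq_adjoint b (hsBasis H)]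

lemma hsNorm_adjoint (T : H →L[ℂ] H) :
    hsNorm (ContinuousLinearMap.adjoint T) = hsNorm T := by
  rw [hsNorm, hsNorm, tsum_enorm_sq_adjoint (hsBasis H) (hsBasis H) T]

lemma hsNorm_zero : hsNorm (0 : H →L[ℂ] H) = 0 := by
  simp [hsNorm]

lemma hsNorm_add_le (S T : H →L[ℂ] H) : hsNorm (S + T) ≤ hsNorm S + hsNorm T := by
  have key : ∀ s : Finset (hsIndex H),
      (∑ i ∈ s, ‖(S + T) (hsBasis H i)‖ₑ ^ (2 : ℝ)) ^ (1 / 2 : ℝ) ≤ hsNorm S + hsNorm T := by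
    intro s
    calc (∑ i ∈ s, ‖(S + T) (hsBasis H i)‖ₑ ^ (2 : ℝ)) ^ (1 / 2 : ℝ)
        ≤ (∑ i ∈ s, (‖S (hsBasis H i)‖ₑ + ‖T (hsBasis H i)‖ₑ) ^ (2 : ℝ)) ^ (1 / 2 : ℝ) := by
          gcongr with i
          exact enorm_add_le _ _
      _ ≤ (∑ i ∈ s, ‖S (hsBasis H i)‖ₑ ^ (2 : ℝ)) ^ (1 / 2 : ℝ)
          + (∑ i ∈ s, ‖T (hsBasis H i)‖ₑ ^ (2 : ℝ)) ^ (1 / 2 : ℝ) :=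
          ENNReal.Lp_add_le s _ _ (by norm_num)
      _ ≤ hsNorm S + hsNorm T := by
          unfold hsNorm
          gcongr <;> exact ENNReal.sum_le_tsum s
  have h2 : ∑' i, ‖(S + T) (hsBasis H i)‖ₑ ^ (2 : ℝ) ≤ (hsNorm S + hsNorm T) ^ (2 : ℝ) := by
    rw [ENNReal.tsum_eq_iSup_sum]
    refine iSup_le fun s => ?_
    have := ENNReal.rpow_le_rpow (key s) (by norm_num : (0 : ℝ) ≤ 2)
    rwa [← ENNReal.rpow_mul, one_div, inv_mul_cancel₀ (by norm_num), ENNReal.rpow_one] at this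
  have := ENNReal.rpow_le_rpow h2 (by norm_num : (0 : ℝ) ≤ 1 / 2)
  rwa [← ENNReal.rpow_mul, one_div, mul_inv_cancel₀ (by norm_num), ENNReal.rpow_one,
    ← one_div] at this

lemma hsNorm_mul_le_left (S T : H →L[ℂ] H) : hsNorm (S * T) ≤ ‖S‖ₑ * hsNorm T := by
  have h : ∑' i, ‖(S * T) (hsBasis H i)‖ₑ ^ (2 : ℝ) ≤
      ‖S‖ₑ ^ (2 : ℝ) * ∑' i, ‖T (hsBasis H i)‖ₑ ^ (2 : ℝ) := by
    rw [← ENNReal.tsum_mul_left]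
    refine ENNReal.tsum_le_tsum fun i => ?_
    rw [← ENNReal.mul_rpow_of_nonneg _ _ (by norm_num)]
    gcongr
    exact S.le_opENorm _
  have := ENNReal.rpow_le_rpow h (by norm_num : (0 : ℝ) ≤ 1 / 2)
  rwa [ENNReal.mul_rpow_of_nonneg _ _ (by norm_num), ← ENNReal.rpow_mul, one_div,
    mul_inv_cancel₀ (by norm_num), ENNReal.rpow_one, ← one_div] at this

lemma hsNorm_mul_le_right (S T : H →L[ℂ] H) : hsNorm (S * T) ≤ hsNorm S * ‖T‖ₑ := by
  have h := hsNorm_mul_le_left (ContinuousLinearMap.adjoint T) (ContinuousLinearMap.adjoint S)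
  have h2 : ContinuousLinearMap.adjoint T * ContinuousLinearMap.adjoint S =
      ContinuousLinearMap.adjoint (S * T) := (ContinuousLinearMap.adjoint_comp S T).symm
  have h3 : ‖ContinuousLinearMap.adjoint T‖ₑ = ‖T‖ₑ := by
    rw [← ofReal_norm, ← ofReal_norm, LinearIsometryEquiv.norm_map]
  rwa [h2, hsNorm_adjoint, hsNorm_adjoint, h3, mul_comm] at h

lemma hsNorm_smul_le (c : ℂ) (T : H →L[ℂ] H) : hsNorm (c • T) ≤ ‖c‖ₑ * hsNorm T := by
  have h := hsNorm_mul_le_left (c • (1 : H →L[ℂ] H)) T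
  rw [smul_mul_assoc, one_mul] at h
  refine h.trans ?_
  gcongr
  rw [enorm_smul]
  calc ‖c‖ₑ * ‖(1 : H →L[ℂ] H)‖ₑ ≤ ‖c‖ₑ * 1 := by
        gcongr
        rw [← ofReal_norm]
        exact ENNReal.ofReal_le_one.2 ContinuousLinearMap.norm_id_le
    _ = ‖c‖ₑ := mul_one _

end HilbertSchmidt

/-- Lebesgue measure on `Ω ⊆ ℂ`. -/
abbrev lebesgueOn (Ω : Set ℂ) : Measure ℂ := (volume : Measure ℂ).restrict Ω

/-- The Hilbert space `L²(Ω, λ)`. -/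
abbrev L2 (Ω : Set ℂ) : Type := Lp ℂ 2 (lebesgueOn Ω)

/-- The algebra `ℬ(L²(Ω, λ))` of bounded operators. -/
abbrev BL2 (Ω : Set ℂ) : Type := L2 Ω →L[ℂ] L2 Ω

/-- The operator `M_f` of multiplication by `f ∈ L^∞(Ω, λ)` on `L²(Ω, λ)`. -/
def mulOp {Ω : Set ℂ} (f : Lp ℂ ∞ (lebesgueOn Ω)) : BL2 Ω :=
  (ContinuousLinearMap.mul ℂ ℂ).holderL (lebesgueOn Ω) ∞ 2 2 f

/-- The difference quotient `Df(s, t) = (f s - f t) / (s - t)`; its value on the diagonal, a null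
set, is irrelevant. -/
def diffQuot (f : ℂ → ℂ) (p : ℂ × ℂ) : ℂ := (f p.1 - f p.2) / (p.1 - p.2)

/-- The essentially Lipschitz functions `Λ(Ω)`: those `f ∈ L^∞(Ω, λ)` with
`Df ∈ L^∞(Ω × Ω, λ ⊗ λ)`. -/
def LambdaSet (Ω : Set ℂ) : Set (Lp ℂ ∞ (lebesgueOn Ω)) :=
  {f | MemLp (diffQuot f) ∞ ((lebesgueOn Ω).prod (lebesgueOn Ω))}

/-- `L(T) = sup {|[M_f, T]|₂ : f ∈ Λ(Ω), ‖Df‖_∞ ≤ 1}`, with values in `[0, ∞]`. -/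
def commL {Ω : Set ℂ} (T : BL2 Ω) : ℝ≥0∞ :=
  ⨆ f ∈ {f ∈ LambdaSet Ω |
    eLpNorm (diffQuot f) ∞ ((lebesgueOn Ω).prod (lebesgueOn Ω)) ≤ 1},
    hsNorm (mulOp f * T - T * mulOp f)

section CommL

variable {Ω : Set ℂ}

lemma commL_zero : commL (0 : BL2 Ω) = 0 := by
  simp [commL, hsNorm_zero]

lemma commL_algebraMap (c : ℂ) : commL (algebraMap ℂ (BL2 Ω) c) = 0 := by
  simp [commL, Algebra.commutes, hsNorm_zero]

lemma commL_add_le (S T : BL2 Ω) : commL (S + T) ≤ commL S + commL T := by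
  refine iSup₂_le fun f hf => ?_
  have e : mulOp f * (S + T) - (S + T) * mulOp f =
      (mulOp f * S - S * mulOp f) + (mulOp f * T - T * mulOp f) := by noncomm_ring
  rw [e]
  refine (hsNorm_add_le _ _).trans (add_le_add ?_ ?_)
  · exact le_iSup₂ (f := fun f _ => hsNorm (mulOp f * S - S * mulOp f)) f hf
  · exact le_iSup₂ (f := fun f _ => hsNorm (mulOp f * T - T * mulOp f)) f hf

lemma commL_smul_le (c : ℂ) (T : BL2 Ω) : commL (c • T) ≤ ‖c‖ₑ * commL T := by
  refine iSup₂_le fun f hf => ?_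
  have e : mulOp f * (c • T) - (c • T) * mulOp f = c • (mulOp f * T - T * mulOp f) := by
    rw [mul_smul_comm, smul_mul_assoc, smul_sub]
  rw [e]
  refine (hsNorm_smul_le _ _).trans ?_
  gcongr
  exact le_iSup₂ (f := fun f _ => hsNorm (mulOp f * T - T * mulOp f)) f hf

lemma commL_neg (T : BL2 Ω) : commL (-T) = commL T := by
  have h : ∀ S : BL2 Ω, commL (-S) ≤ commL S := fun S => by
    simpa using commL_smul_le (-1) S
  exact le_antisymm (h T) (by simpa using h (-T))

lemma commL_mul_le (S T : BL2 Ω) : commL (S * T) ≤ commL S * ‖T‖ₑ + ‖S‖ₑ * commL T := by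
  refine iSup₂_le fun f hf => ?_
  have e : mulOp f * (S * T) - (S * T) * mulOp f =
      (mulOp f * S - S * mulOp f) * T + S * (mulOp f * T - T * mulOp f) := by noncomm_ring
  rw [e]
  refine (hsNorm_add_le _ _).trans (add_le_add ?_ ?_)
  · refine (hsNorm_mul_le_right _ _).trans ?_
    gcongr
    exact le_iSup₂ (f := fun f _ => hsNorm (mulOp f * S - S * mulOp f)) f hf
  · refine (hsNorm_mul_le_left _ _).trans ?_
    gcongr
    exact le_iSup₂ (f := fun f _ => hsNorm (mulOp f * T - T * mulOp f)) f hf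

end CommL

/-- The algebra `EΛ(Ω) = {T ∈ ℬ(L²(Ω, λ)) : L(T) < ∞}`. -/
def ELambda (Ω : Set ℂ) : Subalgebra ℂ (BL2 Ω) where
  carrier := {T | commL T < ∞}
  mul_mem' {S T} hS hT := by
    simp only [Set.mem_ofPred_eq] at hS hT ⊢
    exact (commL_mul_le S T).trans_lt (ENNReal.add_lt_top.2
      ⟨ENNReal.mul_lt_top hS enorm_lt_top, ENNReal.mul_lt_top enorm_lt_top hT⟩)
  add_mem' {S T} hS hT := (commL_add_le S T).trans_lt (ENNReal.add_lt_top.2 ⟨hS, hT⟩)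
  algebraMap_mem' c := by simp [commL_algebraMap]

/-- The compact operators in `EΛ(Ω)`, as a subalgebra of `ℬ(L²(Ω, λ))`. -/
def KLambdaSub (Ω : Set ℂ) : NonUnitalSubalgebra ℂ (BL2 Ω) where
  carrier := {T | T ∈ ELambda Ω ∧ IsCompactOperator T}
  mul_mem' {_ T} hS hT := ⟨mul_mem hS.1 hT.1, hS.2.comp_clm T⟩
  add_mem' {_ _} hS hT := ⟨add_mem hS.1 hT.1, hS.2.add hT.2⟩
  zero_mem' := ⟨zero_mem _, isCompactOperator_zero⟩
  smul_mem' c _ hT := ⟨(ELambda Ω).smul_mem hT.1 c, hT.2.smul c⟩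

/-- The algebra `𝒦Λ(Ω)` of compact operators in `EΛ(Ω)`. As a type of its own, since it carries
the norm `‖T‖ + L(T)` and not the operator norm. -/
def KLambda (Ω : Set ℂ) : Type := KLambdaSub Ω

namespace KLambda

variable {Ω : Set ℂ}

instance : NonUnitalRing (KLambda Ω) := inferInstanceAs (NonUnitalRing (KLambdaSub Ω))

instance : Module ℂ (KLambda Ω) := inferInstanceAs (Module ℂ (KLambdaSub Ω))

instance : SMulCommClass ℂ (KLambda Ω) (KLambda Ω) :=
  inferInstanceAs (SMulCommClass ℂ (KLambdaSub Ω) (KLambdaSub Ω))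

instance : IsScalarTower ℂ (KLambda Ω) (KLambda Ω) :=
  inferInstanceAs (IsScalarTower ℂ (KLambdaSub Ω) (KLambdaSub Ω))

/-- The operator underlying an element of `𝒦Λ(Ω)`. -/
def toOp (x : KLambda Ω) : BL2 Ω := Subtype.val x

lemma toOp_mem (x : KLambda Ω) : x.toOp ∈ ELambda Ω := (Subtype.property x).1

lemma toOp_compact (x : KLambda Ω) : IsCompactOperator x.toOp := (Subtype.property x).2

lemma toOp_injective : Function.Injective (toOp : KLambda Ω → BL2 Ω) := Subtype.val_injective

lemma toOp_zero : (0 : KLambda Ω).toOp = 0 := rfl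

lemma toOp_add (x y : KLambda Ω) : (x + y).toOp = x.toOp + y.toOp := rfl

lemma toOp_neg (x : KLambda Ω) : (-x).toOp = -x.toOp := rfl

lemma toOp_smul (c : ℂ) (x : KLambda Ω) : (c • x).toOp = c • x.toOp := rfl

lemma toOp_mul (x y : KLambda Ω) : (x * y).toOp = x.toOp * y.toOp := rfl

lemma commL_ne_top (x : KLambda Ω) : commL x.toOp ≠ ∞ := (x.toOp_mem : commL x.toOp < ∞).ne

/-- The norm `⦀x⦀ = ‖x‖ + L(x)`. -/
instance : Norm (KLambda Ω) := ⟨fun x => ‖x.toOp‖ + (commL x.toOp).toReal⟩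

lemma norm_def (x : KLambda Ω) : ‖x‖ = ‖x.toOp‖ + (commL x.toOp).toReal := rfl

/-- The norm `⦀·⦀` as a group norm. -/
def addGroupNorm (Ω : Set ℂ) : AddGroupNorm (KLambda Ω) where
  toFun x := ‖x‖
  map_zero' := by simp [norm_def, toOp_zero, commL_zero]
  add_le' x y := by
    have h : (commL (x.toOp + y.toOp)).toReal ≤ (commL x.toOp).toReal + (commL y.toOp).toReal := by
      rw [← ENNReal.toReal_add x.commL_ne_top y.commL_ne_top]
      exact ENNReal.toReal_mono (ENNReal.add_ne_top.2 ⟨x.commL_ne_top, y.commL_ne_top⟩)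
        (commL_add_le _ _)
    have h2 := norm_add_le x.toOp y.toOp
    simp only [norm_def, toOp_add]
    linarith
  neg' x := by simp [norm_def, toOp_neg, commL_neg]
  eq_zero_of_map_eq_zero' x hx := by
    have h1 := norm_nonneg x.toOp
    have h2 : 0 ≤ (commL x.toOp).toReal := ENNReal.toReal_nonneg
    rw [norm_def] at hx
    exact toOp_injective (norm_eq_zero.1 (by linarith))

lemma norm_mul_le_mul_norm (x y : KLambda Ω) : ‖x * y‖ ≤ ‖x‖ * ‖y‖ := by
  have h : (commL (x.toOp * y.toOp)).toReal ≤
      (commL x.toOp).toReal * ‖y.toOp‖ + ‖x.toOp‖ * (commL y.toOp).toReal := by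
    have e : (commL x.toOp * ‖y.toOp‖ₑ + ‖x.toOp‖ₑ * commL y.toOp).toReal =
        (commL x.toOp).toReal * ‖y.toOp‖ + ‖x.toOp‖ * (commL y.toOp).toReal := by
      rw [ENNReal.toReal_add (ENNReal.mul_ne_top x.commL_ne_top enorm_ne_top)
        (ENNReal.mul_ne_top enorm_ne_top y.commL_ne_top), ENNReal.toReal_mul, ENNReal.toReal_mul,
        toReal_enorm, toReal_enorm]
    rw [← e]
    exact ENNReal.toReal_mono (ENNReal.add_ne_top.2
      ⟨ENNReal.mul_ne_top x.commL_ne_top enorm_ne_top,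
        ENNReal.mul_ne_top enorm_ne_top y.commL_ne_top⟩) (commL_mul_le _ _)
  have h2 := norm_mul_le x.toOp y.toOp
  have h3 : 0 ≤ (commL x.toOp).toReal * (commL y.toOp).toReal :=
    mul_nonneg ENNReal.toReal_nonneg ENNReal.toReal_nonneg
  simp only [norm_def, toOp_mul]
  nlinarith

instance : NonUnitalNormedRing (KLambda Ω) :=
  { (inferInstance : NonUnitalRing (KLambda Ω)),
    (addGroupNorm Ω).toNormedAddCommGroup with
    norm_mul_le := norm_mul_le_mul_norm }

instance : NormedSpace ℂ (KLambda Ω) where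
  norm_smul_le c x := by
    have h : (commL (c • x.toOp)).toReal ≤ ‖c‖ * (commL x.toOp).toReal := by
      have := ENNReal.toReal_mono (ENNReal.mul_ne_top enorm_ne_top x.commL_ne_top)
        (commL_smul_le c x.toOp)
      rwa [ENNReal.toReal_mul, toReal_enorm] at this
    change ‖c • x.toOp‖ + (commL (c • x.toOp)).toReal ≤
      ‖c‖ * (‖x.toOp‖ + (commL x.toOp).toReal)
    rw [norm_smul]
    linarith

end KLambda

end

/-! The engine is a sequence u_N of compact operators, bounded in |||·||| and converging strongly to
1 (`tendsto_approxUnit_apply`, `norm_approxUnit_le`).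

Construction of u_N. If T has kernel k(s,t), then [M_f,T] has kernel (f(s)-f(t))k(s,t), so L(T)² ≤
∬|s-t|²|k|² (`commL_sq_le_lintegral`). For the averaging projection over the squares of side 2⁻ᵏ
tiling [-N,N)², about N²4ᵏ squares contribute O(4⁻ᵏ) each: a bound of order N², the same at every
scale but unbounded in N. Kernels of scales j ≤ l are almost orthogonal in this weighted L² norm,
the cross terms decaying like 4^(j-l). Hence the mean over N² consecutive scales gains a factor N⁻²
in the squared bound, and L(u_N) stays bounded (`commL_multiscaleAvg_sq_le`).

Double centralizers. Rank one operators with vectors in the domain of the coordinate lie in 𝒦Λ. Fix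
a unit vector e there, put x = ⟨g,·⟩e and w = T'(x)*e. Then T'(x)y = xT''(y) gives ⟨w, yh⟩ = ⟨g,
T''(y)h⟩, and y = u_N, h = w yields ‖w‖ ≤ 33‖T''‖‖g‖ in the limit. So g ↦ w extends to a bounded
operator; its adjoint T satisfies T''(y) = Ty, and T'(x) = xT follows by cancelling y. Finally T is
the strong limit of T''(u_N), and L is lower semicontinuous for strong convergence, so L(T) < ∞. -/

/-! ### Lower semicontinuity under strong convergence -/

open Filter Topology in
-- Fatou for sums: each finite partial sum of the squared norms is continuous under strong
-- convergence.
lemma hsNorm_le_of_tendsto {H : Type*} [NormedAddCommGroup H] [InnerProductSpace ℂ H]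
    [CompleteSpace H] {X : H →L[ℂ] H} {Y : ℕ → H →L[ℂ] H} {C : ℝ≥0∞}
    (h : ∀ v, Tendsto (fun n => Y n v) atTop (𝓝 (X v))) (hC : ∀ n, hsNorm (Y n) ≤ C) :
    hsNorm X ≤ C := by
  have h2 : ∑' i, ‖X (hsBasis H i)‖ₑ ^ (2 : ℝ) ≤ C ^ (2 : ℝ) := by
    rw [ENNReal.tsum_eq_iSup_sum]
    refine iSup_le fun s => ?_
    have hlim : Tendsto (fun n => ∑ i ∈ s, ‖Y n (hsBasis H i)‖ₑ ^ (2 : ℝ)) atTop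
        (𝓝 (∑ i ∈ s, ‖X (hsBasis H i)‖ₑ ^ (2 : ℝ))) :=
      tendsto_finsetSum _ fun i _ =>
        (ENNReal.continuous_rpow_const.tendsto _).comp ((continuous_enorm.tendsto _).comp (h _))
    refine le_of_tendsto' hlim fun n => (ENNReal.sum_le_tsum s).trans ?_
    have := ENNReal.rpow_le_rpow (hC n) (by norm_num : (0 : ℝ) ≤ 2)
    rwa [hsNorm, ← ENNReal.rpow_mul, one_div, inv_mul_cancel₀ (by norm_num),
      ENNReal.rpow_one] at this
  have := ENNReal.rpow_le_rpow h2 (by norm_num : (0 : ℝ) ≤ 1 / 2)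
  rwa [← ENNReal.rpow_mul, one_div, mul_inv_cancel₀ (by norm_num), ENNReal.rpow_one,
    ← one_div] at this

open Filter Topology in
lemma commL_le_of_tendsto {Ω : Set ℂ} {X : BL2 Ω} {Y : ℕ → BL2 Ω} {C : ℝ≥0∞}
    (h : ∀ v, Tendsto (fun n => Y n v) atTop (𝓝 (X v))) (hC : ∀ n, commL (Y n) ≤ C) :
    commL X ≤ C := by
  refine iSup₂_le fun f hf => hsNorm_le_of_tendsto
    (Y := fun n => mulOp f * Y n - Y n * mulOp f) (fun v => ?_) fun n => ?_
  · exact (((mulOp f).continuous.tendsto _).comp (h v)).sub (h _)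
  · exact le_trans (le_iSup₂ (f := fun f _ => hsNorm (mulOp f * Y n - Y n * mulOp f)) f hf) (hC n)

/-! ### Commutators of integral operators -/

lemma coeFn_mulOp {Ω : Set ℂ} (f : Lp ℂ ∞ (lebesgueOn Ω)) (h : L2 Ω) :
    mulOp f h =ᵐ[lebesgueOn Ω] fun s => f s * h s :=
  (ContinuousLinearMap.mul ℂ ℂ).coeFn_holder f h

lemma enorm_sq_L2 {Ω : Set ℂ} (h : L2 Ω) :
    ‖h‖ₑ ^ (2 : ℝ) = ∫⁻ s, ‖h s‖ₑ ^ (2 : ℝ) ∂(lebesgueOn Ω) := by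
  rw [Lp.enorm_def, eLpNorm_eq_lintegral_rpow_enorm_toReal (by norm_num) (by norm_num),
    ← ENNReal.rpow_mul]
  norm_num

/-- Bessel's inequality for Hilbert-Schmidt norms: if `T h` is given at almost every point `s` by
pairing with a vector `G s`, then `|T|₂² ≤ ∫ ‖G s‖²`. -/
lemma hsNorm_sq_le_lintegral {Ω : Set ℂ} {T : BL2 Ω} {G : ℂ → L2 Ω}
    (hT : ∀ h : L2 Ω, ∀ᵐ s ∂(lebesgueOn Ω), T h s = inner ℂ (G s) h) :
    hsNorm T ^ (2 : ℝ) ≤ ∫⁻ s, ‖G s‖ₑ ^ (2 : ℝ) ∂(lebesgueOn Ω) := by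
  rw [hsNorm, ← ENNReal.rpow_mul, one_div, inv_mul_cancel₀ (by norm_num), ENNReal.rpow_one,
    ENNReal.tsum_eq_iSup_sum]
  refine iSup_le fun F => ?_
  simp_rw [enorm_sq_L2 (T _)]
  rw [← lintegral_finsetSum' _ fun i _ => (Lp.aestronglyMeasurable _).enorm.pow_const _]
  refine lintegral_mono_ae ?_
  have hall : ∀ᵐ s ∂(lebesgueOn Ω), ∀ i ∈ F, T (hsBasis _ i) s = inner ℂ (G s) (hsBasis _ i) :=
    (Finset.eventually_all F).2 fun i _ => hT _
  filter_upwards [hall] with s hs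
  rw [enorm_sq_eq_tsum (hsBasis (L2 Ω)) (G s)]
  refine le_trans (le_of_eq (Finset.sum_congr rfl fun i hi => ?_)) (ENNReal.sum_le_tsum F)
  rw [hs i hi, ← inner_conj_symm, ← ofReal_norm, ← ofReal_norm, RCLike.norm_conj]

lemma enorm_sub_le_of_eLpNorm_diffQuot_le_one {Ω : Set ℂ} {f : ℂ → ℂ}
    (hf : eLpNorm (diffQuot f) ∞ ((lebesgueOn Ω).prod (lebesgueOn Ω)) ≤ 1) :
    ∀ᵐ s ∂(lebesgueOn Ω), ∀ᵐ t ∂(lebesgueOn Ω), ‖f s - f t‖ₑ ≤ ‖s - t‖ₑ := by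
  have h : ∀ᵐ p ∂((lebesgueOn Ω).prod (lebesgueOn Ω)), ‖diffQuot f p‖ₑ ≤ 1 := by
    rw [eLpNorm_exponent_top] at hf
    filter_upwards [ae_le_eLpNormEssSup (f := diffQuot f)
      (μ := (lebesgueOn Ω).prod (lebesgueOn Ω))] with p hp using hp.trans hf
  filter_upwards [Measure.ae_ae_of_ae_prod h] with s hs
  filter_upwards [hs] with t ht
  rcases eq_or_ne s t with rfl | hne
  · simp
  · have e : f s - f t = diffQuot f (s, t) * (s - t) := by
      simp only [diffQuot]
      rw [div_mul_cancel₀ _ (sub_ne_zero.2 hne)]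
    rw [e, enorm_mul]
    exact (mul_le_mul_left ht _).trans_eq (one_mul _)

/-- The Lipschitz commutator bound for integral operators. -/
lemma commL_sq_le_lintegral {Ω : Set ℂ} {T : BL2 Ω} {k : ℂ → ℂ → ℂ}
    (hk : ∀ s, MemLp (k s) 2 (lebesgueOn Ω))
    (hT : ∀ h : L2 Ω, ∀ᵐ s ∂(lebesgueOn Ω), T h s = ∫ t, k s t * h t ∂(lebesgueOn Ω)) :
    commL T ^ (2 : ℝ) ≤ ∫⁻ s, ∫⁻ t, ‖s - t‖ₑ ^ (2 : ℝ) * ‖k s t‖ₑ ^ (2 : ℝ)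
      ∂(lebesgueOn Ω) ∂(lebesgueOn Ω) := by
  set μ := lebesgueOn Ω with hμ
  set B := ∫⁻ s, ∫⁻ t, ‖s - t‖ₑ ^ (2 : ℝ) * ‖k s t‖ₑ ^ (2 : ℝ) ∂μ ∂μ
  suffices H : commL T ≤ B ^ (1 / 2 : ℝ) by
    have := ENNReal.rpow_le_rpow H (by norm_num : (0 : ℝ) ≤ 2)
    rwa [← ENNReal.rpow_mul, one_div, inv_mul_cancel₀ (by norm_num), ENNReal.rpow_one] at this
  refine iSup₂_le fun f hf => ?_
  -- The commutator has kernel (f s - f t) * k s t; the conjugate compensates for the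
  -- conjugate-linear first slot of `inner`.
  have hfk : ∀ s, MemLp (fun t => (starRingEnd ℂ) ((f s - f t) * k s t)) 2 μ := by
    intro s
    have h1 : MemLp (fun t => f s - f t) ∞ μ := (memLp_top_const (f s)).sub (Lp.memLp f)
    have h2 : MemLp (fun t => (f s - f t) * k s t) 2 μ := (hk s).mul h1
    exact h2.star
  have hG := hsNorm_sq_le_lintegral (T := mulOp f * T - T * mulOp f)
    (G := fun s => (hfk s).toLp _) (fun h => ?_)
  · have hB : hsNorm (mulOp f * T - T * mulOp f) ^ (2 : ℝ) ≤ B := by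
      refine hG.trans (lintegral_mono_ae ?_)
      filter_upwards [enorm_sub_le_of_eLpNorm_diffQuot_le_one hf.2] with s hs
      rw [enorm_sq_L2]
      refine lintegral_mono_ae ?_
      filter_upwards [hs, (hfk s).coeFn_toLp] with t ht he
      rw [he, ← ofReal_norm, RCLike.norm_conj, ofReal_norm, enorm_mul,
        ENNReal.mul_rpow_of_nonneg _ _ (by norm_num)]
      gcongr
    have := ENNReal.rpow_le_rpow hB (by norm_num : (0 : ℝ) ≤ 1 / 2)
    rwa [← ENNReal.rpow_mul, one_div, mul_inv_cancel₀ (by norm_num), ENNReal.rpow_one,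
      ← one_div] at this
  · have e : (mulOp f * T - T * mulOp f) h = mulOp f (T h) - T (mulOp f h) := rfl
    filter_upwards [Lp.coeFn_sub (mulOp f (T h)) (T (mulOp f h)), coeFn_mulOp f (T h), hT h,
      hT (mulOp f h)] with s h1 h2 h3 h4
    rw [e, h1, Pi.sub_apply, h2, h3, h4, L2.inner_def, ← integral_const_mul, ← integral_sub]
    · refine integral_congr_ae ?_
      filter_upwards [(hfk s).coeFn_toLp, coeFn_mulOp f h] with t h5 h6
      rw [h5, h6]
      simp only [RCLike.inner_apply, Complex.conj_conj]
      ring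
    · exact (((hk s).integrable_mul (Lp.memLp h)).const_mul _)
    · exact (hk s).integrable_mul (Lp.memLp (mulOp f h))

/-! ### Rank one operators in 𝒦Λ(Ω) -/

/-- The square integrable functions `g` such that `s ↦ s g(s)` is square integrable, that is, the
domain of multiplication by the coordinate. -/
def coordDomain (Ω : Set ℂ) : Submodule ℂ (L2 Ω) where
  carrier := {g | MemLp (fun s => s * g s) 2 (lebesgueOn Ω)}
  add_mem' {g h} hg hh := by
    refine (MemLp.add hg hh).ae_eq ?_
    filter_upwards [Lp.coeFn_add g h] with s hs
    change s * g s + s * h s = s * (g + h : L2 Ω) s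
    rw [hs, Pi.add_apply, mul_add]
  zero_mem' := by
    refine (MemLp.zero (p := 2) (μ := lebesgueOn Ω) (ε := ℂ)).ae_eq ?_
    filter_upwards [Lp.coeFn_zero ℂ 2 (lebesgueOn Ω)] with s hs
    change 0 = s * (0 : L2 Ω) s
    rw [hs, Pi.zero_apply, mul_zero]
  smul_mem' c g hg := by
    refine (MemLp.const_mul hg c).ae_eq ?_
    filter_upwards [Lp.coeFn_smul c g] with s hs
    simp only [hs, Pi.smul_apply, smul_eq_mul]
    ring

/-- Continuous functions with compact support are dense in `L²`. -/
lemma exists_continuous_toLp_dist_lt {Ω : Set ℂ} (h : L2 Ω) {ε : ℝ} (hε : 0 < ε) :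
    ∃ (g : ℂ → ℂ) (hg : MemLp g 2 (lebesgueOn Ω)), HasCompactSupport g ∧ Continuous g ∧
      dist h (hg.toLp g) < ε := by
  obtain ⟨g, hgs, hgε, hgc, hg⟩ := (Lp.memLp h).exists_hasCompactSupport_eLpNorm_sub_le
    (by norm_num) (ε := ENNReal.ofReal (ε / 2)) (by simpa using hε)
  refine ⟨g, hg, hgs, hgc, ?_⟩
  have h1 : edist h (hg.toLp g) ≤ ENNReal.ofReal (ε / 2) := by
    rw [Lp.edist_def]
    refine le_trans (le_of_eq (eLpNorm_congr_ae ?_)) hgε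
    filter_upwards [hg.coeFn_toLp] with s hs
    simp [hs]
  rw [edist_dist, ENNReal.ofReal_le_ofReal_iff (by positivity)] at h1
  linarith

lemma dense_coordDomain (Ω : Set ℂ) : Dense (coordDomain Ω : Set (L2 Ω)) := fun h =>
  Metric.mem_closure_iff.2 fun ε hε => by
    obtain ⟨g, hg, hgs, hgc, hd⟩ := exists_continuous_toLp_dist_lt h hε
    refine ⟨hg.toLp g, ?_, hd⟩
    have h1 : MemLp (fun s : ℂ => s * g s) 2 (lebesgueOn Ω) :=
      (continuous_id.mul hgc).memLp_of_hasCompactSupport (hgs.mul_left (f := fun s => s))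
    refine h1.ae_eq ?_
    filter_upwards [hg.coeFn_toLp] with s hs
    simp [hs]

lemma rankOne_apply_ae {Ω : Set ℂ} (a b h : L2 Ω) :
    ∀ᵐ s ∂(lebesgueOn Ω), InnerProductSpace.rankOne ℂ a b h s =
      ∫ t, (a s * (starRingEnd ℂ) (b t)) * h t ∂(lebesgueOn Ω) := by
  rw [InnerProductSpace.rankOne_apply]
  filter_upwards [Lp.coeFn_smul (inner ℂ b h) a] with s hs
  rw [hs, Pi.smul_apply, smul_eq_mul, L2.inner_def, mul_comm, ← integral_const_mul]
  refine integral_congr_ae (.of_forall fun t => ?_)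
  simp only [RCLike.inner_apply]
  ring

lemma lintegral_sq_lt_top {Ω : Set ℂ} {g : ℂ → ℂ} (hg : MemLp g 2 (lebesgueOn Ω)) :
    ∫⁻ s, ‖g s‖ₑ ^ (2 : ℝ) ∂(lebesgueOn Ω) < ∞ := by
  have := lintegral_rpow_enorm_lt_top_of_eLpNorm_lt_top (by norm_num) (by norm_num) hg.2
  simpa using this

lemma enorm_sub_rpow_two_le (s t : ℂ) :
    ‖s - t‖ₑ ^ (2 : ℝ) ≤ 2 * ‖s‖ₑ ^ (2 : ℝ) + 2 * ‖t‖ₑ ^ (2 : ℝ) := by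
  have h1 : ‖s - t‖ₑ ≤ ‖s‖ₑ + ‖t‖ₑ := enorm_sub_le
  refine (ENNReal.rpow_le_rpow h1 (by norm_num)).trans ?_
  have h2 := ENNReal.rpow_add_le_mul_rpow_add_rpow ‖s‖ₑ ‖t‖ₑ (by norm_num : (1 : ℝ) ≤ 2)
  rw [← mul_add]
  norm_num at h2 ⊢
  exact h2

/-- Since |s-t|² ≤ 2|s|² + 2|t|², the weighted kernel integral splits into products of the squared
L² norms of a, b, s·a and t·b. -/
lemma commL_rankOne_lt_top {Ω : Set ℂ} {a b : L2 Ω} (ha : a ∈ coordDomain Ω)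
    (hb : b ∈ coordDomain Ω) : commL (InnerProductSpace.rankOne ℂ a b : BL2 Ω) < ∞ := by
  set μ := lebesgueOn Ω with hμ
  have hle := commL_sq_le_lintegral (T := InnerProductSpace.rankOne ℂ a b)
    (k := fun s t => a s * (starRingEnd ℂ) (b t))
    (fun s => (Lp.memLp b).star.const_mul _) (rankOne_apply_ae a b)
  suffices h : ∫⁻ s, ∫⁻ t, ‖s - t‖ₑ ^ (2 : ℝ) * ‖a s * (starRingEnd ℂ) (b t)‖ₑ ^ (2 : ℝ)
      ∂μ ∂μ < ∞ by
    by_contra hc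
    rw [not_lt, top_le_iff] at hc
    rw [hc] at hle
    simp only [ENNReal.top_rpow_of_pos (by norm_num : (0 : ℝ) < 2), top_le_iff] at hle
    exact h.ne hle
  have hA : AEMeasurable (fun s => ‖a s‖ₑ ^ (2 : ℝ)) μ :=
    (Lp.aestronglyMeasurable a).enorm.pow_const _
  have hB : AEMeasurable (fun s => ‖b s‖ₑ ^ (2 : ℝ)) μ :=
    (Lp.aestronglyMeasurable b).enorm.pow_const _
  have hA' : AEMeasurable (fun s => ‖s * a s‖ₑ ^ (2 : ℝ)) μ :=
    (MemLp.aestronglyMeasurable ha).enorm.pow_const _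
  have hB' : AEMeasurable (fun s => ‖s * b s‖ₑ ^ (2 : ℝ)) μ :=
    (MemLp.aestronglyMeasurable hb).enorm.pow_const _
  calc _ ≤ ∫⁻ s, ∫⁻ t, (2 * ‖s * a s‖ₑ ^ (2 : ℝ)) * ‖b t‖ₑ ^ (2 : ℝ) +
        (2 * ‖a s‖ₑ ^ (2 : ℝ)) * ‖t * b t‖ₑ ^ (2 : ℝ) ∂μ ∂μ := by
        refine lintegral_mono fun s => lintegral_mono fun t => ?_
        have e : ‖(starRingEnd ℂ) (b t)‖ₑ = ‖b t‖ₑ := by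
          rw [← ofReal_norm, RCLike.norm_conj, ofReal_norm]
        simp only [enorm_mul, e, ENNReal.mul_rpow_of_nonneg _ _ (by norm_num : (0 : ℝ) ≤ 2)]
        refine (mul_le_mul_left (enorm_sub_rpow_two_le s t) _).trans (le_of_eq ?_)
        ring
    _ = 2 * (∫⁻ s, ‖s * a s‖ₑ ^ (2 : ℝ) ∂μ) * (∫⁻ t, ‖b t‖ₑ ^ (2 : ℝ) ∂μ) +
        2 * (∫⁻ s, ‖a s‖ₑ ^ (2 : ℝ) ∂μ) * (∫⁻ t, ‖t * b t‖ₑ ^ (2 : ℝ) ∂μ) := by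
        have e : ∀ s, ∫⁻ t, (2 * ‖s * a s‖ₑ ^ (2 : ℝ)) * ‖b t‖ₑ ^ (2 : ℝ) +
            (2 * ‖a s‖ₑ ^ (2 : ℝ)) * ‖t * b t‖ₑ ^ (2 : ℝ) ∂μ =
            (2 * ‖s * a s‖ₑ ^ (2 : ℝ)) * (∫⁻ t, ‖b t‖ₑ ^ (2 : ℝ) ∂μ) +
            (2 * ‖a s‖ₑ ^ (2 : ℝ)) * (∫⁻ t, ‖t * b t‖ₑ ^ (2 : ℝ) ∂μ) := fun s => by
          rw [lintegral_add_left' (hB.const_mul _), lintegral_const_mul'' _ hB,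
            lintegral_const_mul'' _ hB']
        simp_rw [e]
        rw [lintegral_add_left' ((hA'.const_mul _).mul_const _),
          lintegral_mul_const'' _ (hA'.const_mul _), lintegral_mul_const'' _ (hA.const_mul _),
          lintegral_const_mul'' _ hA, lintegral_const_mul'' _ hA']
    _ < ∞ := by
        have h1 := lintegral_sq_lt_top (Lp.memLp a)
        have h2 := lintegral_sq_lt_top (Lp.memLp b)
        have h3 := lintegral_sq_lt_top ha
        have h4 := lintegral_sq_lt_top hb
        exact ENNReal.add_lt_top.2
          ⟨ENNReal.mul_lt_top (ENNReal.mul_lt_top (by norm_num) h3) h2,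
            ENNReal.mul_lt_top (ENNReal.mul_lt_top (by norm_num) h1) h4⟩

lemma isCompactOperator_rankOne {H : Type*} [NormedAddCommGroup H] [InnerProductSpace ℂ H]
    (a b : H) : IsCompactOperator (InnerProductSpace.rankOne ℂ a b : H →L[ℂ] H) := by
  rw [InnerProductSpace.rankOne_def']
  exact (isCompactOperator_of_locallyCompactSpace_rng
    (ContinuousLinearMap.toSpanSingleton ℂ a)).comp_clm _

/-- The operator `⟨b, ·⟩ a` as an element of `𝒦Λ(Ω)`. -/
noncomputable def KLambda.rankOne {Ω : Set ℂ} (a b : coordDomain Ω) : KLambda Ω :=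
  ⟨InnerProductSpace.rankOne ℂ (a : L2 Ω) (b : L2 Ω),
    commL_rankOne_lt_top a.2 b.2, isCompactOperator_rankOne _ _⟩

lemma KLambda.toOp_rankOne_apply {Ω : Set ℂ} (a b : coordDomain Ω) (h : L2 Ω) :
    (KLambda.rankOne a b).toOp h = inner ℂ (b : L2 Ω) h • (a : L2 Ω) := rfl

/-! ### Dyadic averaging projections -/

open scoped NNReal

/-- The index of the dyadic square of side `2⁻ᵏ` containing `s`. -/
noncomputable def dyadicIndex (k : ℕ) (s : ℂ) : ℤ × ℤ := (⌊2 ^ k * s.re⌋, ⌊2 ^ k * s.im⌋)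

/-- The dyadic square of side `2⁻ᵏ` with index `i`. -/
def dyadicSquare (k : ℕ) (i : ℤ × ℤ) : Set ℂ := dyadicIndex k ⁻¹' {i}

lemma measurable_dyadicIndex (k : ℕ) : Measurable (dyadicIndex k) :=
  (Int.measurable_floor.comp (Complex.measurable_re.const_mul _)).prodMk
    (Int.measurable_floor.comp (Complex.measurable_im.const_mul _))

lemma measurableSet_dyadicSquare (k : ℕ) (i : ℤ × ℤ) : MeasurableSet (dyadicSquare k i) :=
  measurable_dyadicIndex k (measurableSet_singleton i)

lemma norm_sub_sq_le_of_dyadicIndex_eq {k : ℕ} {s t : ℂ} (h : dyadicIndex k s = dyadicIndex k t) :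
    ‖s - t‖ ^ 2 ≤ 2 * (1 / 4) ^ k := by
  have key : ∀ x y : ℝ, ⌊2 ^ k * x⌋ = ⌊2 ^ k * y⌋ → (x - y) ^ 2 ≤ (1 / 4) ^ k := by
    intro x y hxy
    have h1 := Int.abs_sub_lt_one_of_floor_eq_floor hxy
    rw [← mul_sub] at h1
    have h2 : (2 ^ k * (x - y)) ^ 2 ≤ 1 := by
      rw [← sq_abs]
      exact pow_le_one₀ (abs_nonneg _) h1.le
    have h3 : ((2 : ℝ) ^ k) ^ 2 = 4 ^ k := by rw [← pow_mul, mul_comm, pow_mul]; norm_num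
    rw [mul_pow, h3] at h2
    rw [one_div, inv_pow, ← one_div, le_div_iff₀ (by positivity)]
    linarith
  have h1 := key _ _ (congrArg Prod.fst h)
  have h2 := key _ _ (congrArg Prod.snd h)
  rw [← Complex.normSq_eq_norm_sq, Complex.normSq_apply, Complex.sub_re, Complex.sub_im]
  nlinarith

lemma measure_dyadicSquare_lt_top (Ω : Set ℂ) (k : ℕ) (i : ℤ × ℤ) :
    lebesgueOn Ω (dyadicSquare k i) < ∞ := by
  refine (Measure.restrict_apply_le _ _).trans_lt (Bornology.IsBounded.measure_lt_top ?_)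
  refine Metric.isBounded_iff.2 ⟨2, fun s hs t ht => ?_⟩
  have h1 := norm_sub_sq_le_of_dyadicIndex_eq (k := k) (s := s) (t := t) (Eq.trans hs (Eq.symm ht))
  have h2 : (1 / 4 : ℝ) ^ k ≤ 1 := pow_le_one₀ (by norm_num) (by norm_num)
  rw [dist_eq_norm]
  nlinarith [norm_nonneg (s - t)]

/-- The indicator function of a dyadic square, as an element of `L²`. -/
noncomputable def dyadicVec (Ω : Set ℂ) (k : ℕ) (i : ℤ × ℤ) : L2 Ω :=
  indicatorConstLp 2 (measurableSet_dyadicSquare k i) (measure_dyadicSquare_lt_top Ω k i).ne 1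

/-- The reciprocal of the measure of a dyadic square. -/
noncomputable def dyadicWeight (Ω : Set ℂ) (k : ℕ) (i : ℤ × ℤ) : ℝ≥0 :=
  (lebesgueOn Ω (dyadicSquare k i)).toNNReal⁻¹

/-- Only an inequality, because a square meeting Ω in a null set has weight 0⁻¹ = 0. -/
lemma dyadicWeight_mul_measure_le (Ω : Set ℂ) (k : ℕ) (i : ℤ × ℤ) :
    (dyadicWeight Ω k i : ℝ≥0∞) * lebesgueOn Ω (dyadicSquare k i) ≤ 1 := by
  obtain ⟨m, hm⟩ : ∃ m : ℝ≥0, (m : ℝ≥0∞) = lebesgueOn Ω (dyadicSquare k i) :=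
    ⟨_, ENNReal.coe_toNNReal (measure_dyadicSquare_lt_top Ω k i).ne⟩
  rw [dyadicWeight, ← hm, ENNReal.toNNReal_coe, ← ENNReal.coe_mul]
  exact_mod_cast inv_mul_le_one

/-- The averaging operator over finitely many dyadic squares of side `2⁻ᵏ`. -/
noncomputable def dyadicAvg (Ω : Set ℂ) (k : ℕ) (F : Finset (ℤ × ℤ)) : BL2 Ω :=
  ∑ i ∈ F, ((dyadicWeight Ω k i : ℝ) : ℂ) •
    InnerProductSpace.rankOne ℂ (dyadicVec Ω k i) (dyadicVec Ω k i)

lemma dyadicAvg_apply (Ω : Set ℂ) (k : ℕ) (F : Finset (ℤ × ℤ)) (h : L2 Ω) :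
    dyadicAvg Ω k F h = ∑ i ∈ F, ((dyadicWeight Ω k i : ℝ) : ℂ) •
      inner ℂ (dyadicVec Ω k i) h • dyadicVec Ω k i := by
  simp only [dyadicAvg, sum_apply, smul_apply, InnerProductSpace.rankOne_apply]

lemma isCompactOperator_dyadicAvg (Ω : Set ℂ) (k : ℕ) (F : Finset (ℤ × ℤ)) :
    IsCompactOperator (dyadicAvg Ω k F) :=
  Submodule.sum_mem (compactOperator (RingHom.id ℂ) (L2 Ω) (L2 Ω))
    fun _ _ => Submodule.smul_mem _ _ (isCompactOperator_rankOne _ _)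

/-- Disjoint squares give orthogonal indicators, and the weight normalizes each one: the summands of
`dyadicAvg` are mutually orthogonal projections. -/
lemma weight_smul_inner_smul_dyadicVec (Ω : Set ℂ) (k : ℕ) (i j : ℤ × ℤ) :
    ((dyadicWeight Ω k i : ℝ) : ℂ) • inner ℂ (dyadicVec Ω k i) (dyadicVec Ω k j) • dyadicVec Ω k i
      = if i = j then dyadicVec Ω k j else 0 := by
  have hin : inner ℂ (dyadicVec Ω k i) (dyadicVec Ω k j) =
      (((lebesgueOn Ω).real (dyadicSquare k i ∩ dyadicSquare k j) : ℝ) : ℂ) :=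
    L2.inner_indicatorConstLp_one_indicatorConstLp_one _ _ _ _
  rw [hin]
  split_ifs with hij
  · subst hij
    rw [Set.inter_self, smul_smul, dyadicWeight, ← Complex.ofReal_mul, NNReal.coe_inv]
    change (((((lebesgueOn Ω).real (dyadicSquare k i))⁻¹ *
      (lebesgueOn Ω).real (dyadicSquare k i) : ℝ)) : ℂ) • _ = _
    -- For a null square the weight is 0, but its vector vanishes too, so the identity survives.
    by_cases h0 : (lebesgueOn Ω).real (dyadicSquare k i) = 0
    · have : dyadicVec Ω k i = 0 := by
        rw [← norm_eq_zero, dyadicVec, norm_indicatorConstLp (by norm_num) (by norm_num), h0]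
        norm_num
      rw [this, smul_zero]
    · rw [inv_mul_cancel₀ h0, Complex.ofReal_one, one_smul]
  · have : dyadicSquare k i ∩ dyadicSquare k j = ∅ :=
      Set.eq_empty_of_forall_notMem fun s hs => hij (Eq.trans (Eq.symm hs.1) hs.2)
    simp [this]

lemma dyadicAvg_dyadicVec (Ω : Set ℂ) (k : ℕ) {F : Finset (ℤ × ℤ)} {j : ℤ × ℤ} (hj : j ∈ F) :
    dyadicAvg Ω k F (dyadicVec Ω k j) = dyadicVec Ω k j := by
  rw [dyadicAvg_apply]
  simp_rw [weight_smul_inner_smul_dyadicVec]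
  simp [hj]

/-- A symmetric idempotent P is a contraction: ‖Ph‖² = ⟨h, Ph⟩ ≤ ‖h‖‖Ph‖. -/
lemma norm_dyadicAvg_apply_le (Ω : Set ℂ) (k : ℕ) (F : Finset (ℤ × ℤ)) (h : L2 Ω) :
    ‖dyadicAvg Ω k F h‖ ≤ ‖h‖ := by
  have hidem : dyadicAvg Ω k F (dyadicAvg Ω k F h) = dyadicAvg Ω k F h := by
    conv_lhs => rw [dyadicAvg_apply Ω k F h]
    rw [map_sum, dyadicAvg_apply]
    refine Finset.sum_congr rfl fun i hi => ?_
    rw [map_smul, map_smul, dyadicAvg_dyadicVec Ω k hi]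
  have hsymm : ∀ x y, inner ℂ (dyadicAvg Ω k F x) y = inner ℂ x (dyadicAvg Ω k F y) := by
    intro x y
    rw [dyadicAvg_apply, dyadicAvg_apply, sum_inner, inner_sum]
    refine Finset.sum_congr rfl fun i _ => ?_
    simp only [inner_smul_left, inner_smul_right, inner_conj_symm, Complex.conj_ofReal]
    ring
  have h1 : ‖dyadicAvg Ω k F h‖ ^ 2 ≤ ‖h‖ * ‖dyadicAvg Ω k F h‖ := by
    have h2 := inner_self_eq_norm_sq_to_K (𝕜 := ℂ) (dyadicAvg Ω k F h)
    rw [hsymm, hidem] at h2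
    have h3 := norm_inner_le_norm (𝕜 := ℂ) h (dyadicAvg Ω k F h)
    rw [h2] at h3
    simpa using h3
  by_contra! hc
  have : 0 < ‖dyadicAvg Ω k F h‖ := (norm_nonneg h).trans_lt hc
  nlinarith

/-! ### Integral kernels of the averages -/

open Classical in
/-- The value of the integral kernel of `dyadicAvg` on the diagonal square containing `s`. -/
noncomputable def dyadicDensity (Ω : Set ℂ) (k : ℕ) (F : Finset (ℤ × ℤ)) (s : ℂ) : ℝ≥0 :=
  if dyadicIndex k s ∈ F then dyadicWeight Ω k (dyadicIndex k s) else 0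

/-- The integral kernel of `dyadicAvg`. -/
noncomputable def dyadicKernel (Ω : Set ℂ) (k : ℕ) (F : Finset (ℤ × ℤ)) (s t : ℂ) : ℝ≥0 :=
  dyadicDensity Ω k F s * (dyadicSquare k (dyadicIndex k s)).indicator 1 t

lemma measurable_dyadicKernel (Ω : Set ℂ) (k : ℕ) (F : Finset (ℤ × ℤ)) (s : ℂ) :
    Measurable (dyadicKernel Ω k F s) :=
  (measurable_one.indicator (measurableSet_dyadicSquare k _)).const_mul _

lemma measurable_dyadicDensity (Ω : Set ℂ) (k : ℕ) (F : Finset (ℤ × ℤ)) :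
    Measurable (dyadicDensity Ω k F) := by
  classical
  exact (Measurable.of_discrete (f := fun i => if i ∈ F then dyadicWeight Ω k i else 0)).comp
    (measurable_dyadicIndex k)

lemma sum_smul_dyadicVec_ae (Ω : Set ℂ) (k : ℕ) (F : Finset (ℤ × ℤ)) (a : ℤ × ℤ → ℂ) :
    ∀ᵐ s ∂(lebesgueOn Ω), (∑ i ∈ F, a i • dyadicVec Ω k i : L2 Ω) s =
      F.sum fun i => if dyadicIndex k s = i then a i else 0 := by
  have h1 : ∀ᵐ s ∂(lebesgueOn Ω), ∀ i, (a i • dyadicVec Ω k i : L2 Ω) s =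
      if dyadicIndex k s = i then a i else 0 := by
    classical
    refine ae_all_iff.2 fun i => ?_
    have hv : dyadicVec Ω k i =ᵐ[lebesgueOn Ω] (dyadicSquare k i).indicator fun _ => 1 :=
      indicatorConstLp_coeFn
    filter_upwards [hv, Lp.coeFn_smul (a i) (dyadicVec Ω k i)] with s h1 h2
    rw [h2, Pi.smul_apply, h1, Set.indicator_apply]
    by_cases hs : dyadicIndex k s = i
    · rw [if_pos hs, if_pos (show s ∈ dyadicSquare k i from hs)]
      simp
    · rw [if_neg hs, if_neg (show s ∉ dyadicSquare k i from hs)]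
      simp
  filter_upwards [h1, Lp.coeFn_finsetSum F fun i => a i • dyadicVec Ω k i] with s h2 h3
  rw [h3, Finset.sum_apply]
  simp_rw [h2]

lemma dyadicAvg_apply_ae (Ω : Set ℂ) (k : ℕ) (F : Finset (ℤ × ℤ)) (h : L2 Ω) :
    ∀ᵐ s ∂(lebesgueOn Ω), dyadicAvg Ω k F h s =
      ∫ t, ((dyadicKernel Ω k F s t : ℝ) : ℂ) * h t ∂(lebesgueOn Ω) := by
  have e : dyadicAvg Ω k F h = ∑ i ∈ F, (((dyadicWeight Ω k i : ℝ) : ℂ) *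
      ∫ t in dyadicSquare k i, h t ∂(lebesgueOn Ω)) • dyadicVec Ω k i := by
    rw [dyadicAvg_apply]
    refine Finset.sum_congr rfl fun i _ => ?_
    rw [smul_smul]
    congr 2
    exact L2.inner_indicatorConstLp_one _ _ _
  rw [e]
  filter_upwards [sum_smul_dyadicVec_ae Ω k F fun i => ((dyadicWeight Ω k i : ℝ) : ℂ) *
      ∫ t in dyadicSquare k i, h t ∂(lebesgueOn Ω)] with s h1
  rw [h1, Finset.sum_ite_eq]
  simp only [dyadicKernel, dyadicDensity]
  split_ifs with hs
  · rw [← integral_const_mul, ← integral_indicator (measurableSet_dyadicSquare k _)]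
    refine integral_congr_ae (.of_forall fun t => ?_)
    by_cases ht : t ∈ dyadicSquare k (dyadicIndex k s) <;> simp [ht]
  · simp

lemma lintegral_dyadicKernel_le_one (Ω : Set ℂ) (k : ℕ) (F : Finset (ℤ × ℤ)) (s : ℂ) :
    ∫⁻ t, (dyadicKernel Ω k F s t : ℝ≥0∞) ∂(lebesgueOn Ω) ≤ 1 := by
  have e : ∀ t, (dyadicKernel Ω k F s t : ℝ≥0∞) = (dyadicDensity Ω k F s : ℝ≥0∞) *
      (dyadicSquare k (dyadicIndex k s)).indicator 1 t := fun t => by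
    by_cases ht : t ∈ dyadicSquare k (dyadicIndex k s) <;> simp [dyadicKernel, ht]
  simp_rw [e]
  rw [lintegral_const_mul _ (measurable_one.indicator (measurableSet_dyadicSquare k _)),
    lintegral_indicator_one (measurableSet_dyadicSquare k _)]
  unfold dyadicDensity
  split_ifs
  · exact dyadicWeight_mul_measure_le _ _ _
  · simp

/-- The integral of the kernel over the diagonal is the trace of the projection: each non-null
square contributes 1, each null square 0. -/
lemma lintegral_dyadicDensity_le (Ω : Set ℂ) (k : ℕ) (F : Finset (ℤ × ℤ)) :
    ∫⁻ s, (dyadicDensity Ω k F s : ℝ≥0∞) ∂(lebesgueOn Ω) ≤ F.card := by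
  classical
  have e : ∀ s, (dyadicDensity Ω k F s : ℝ≥0∞) = ∑ i ∈ F, (dyadicWeight Ω k i : ℝ≥0∞) *
      (dyadicSquare k i).indicator 1 s := fun s => by
    have : ∀ i, (dyadicWeight Ω k i : ℝ≥0∞) * (dyadicSquare k i).indicator 1 s =
        if dyadicIndex k s = i then (dyadicWeight Ω k i : ℝ≥0∞) else 0 := fun i => by
      by_cases hs : dyadicIndex k s = i
      · simp [hs, show s ∈ dyadicSquare k i from hs]
      · simp [hs, show s ∉ dyadicSquare k i from hs]
    simp_rw [this]
    rw [Finset.sum_ite_eq, dyadicDensity]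
    split_ifs <;> simp
  simp_rw [e]
  rw [lintegral_finsetSum _ fun i _ =>
    (measurable_one.indicator (measurableSet_dyadicSquare k _)).const_mul _]
  calc _ ≤ ∑ i ∈ F, (1 : ℝ≥0∞) := Finset.sum_le_sum fun i _ => by
        rw [lintegral_const_mul _ (measurable_one.indicator (measurableSet_dyadicSquare k _)),
          lintegral_indicator_one (measurableSet_dyadicSquare k _)]
        exact dyadicWeight_mul_measure_le _ _ _
    _ = F.card := by simp

lemma enorm_sub_rpow_two_mul_dyadicKernel_le (Ω : Set ℂ) (k : ℕ) (F : Finset (ℤ × ℤ)) (s t : ℂ) :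
    ‖s - t‖ₑ ^ (2 : ℝ) * (dyadicKernel Ω k F s t : ℝ≥0∞) ≤
      2 * (1 / 4) ^ k * (dyadicKernel Ω k F s t : ℝ≥0∞) := by
  by_cases ht : t ∈ dyadicSquare k (dyadicIndex k s)
  · gcongr
    have h := norm_sub_sq_le_of_dyadicIndex_eq (k := k) (s := s) (t := t) (Eq.symm ht)
    have h2 := ENNReal.ofReal_le_ofReal h
    rw [ENNReal.ofReal_pow (norm_nonneg _), ofReal_norm, ENNReal.ofReal_mul (by norm_num),
      ENNReal.ofReal_pow (by norm_num), ENNReal.ofReal_div_of_pos (by norm_num)] at h2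
    simpa using h2
  · simp [dyadicKernel, ht]

/-- Two averaging kernels of different scales are almost orthogonal. -/
lemma lintegral_dyadicKernel_mul_le (Ω : Set ℂ) (k l : ℕ) (F G : Finset (ℤ × ℤ)) (s : ℂ) :
    ∫⁻ t, ‖s - t‖ₑ ^ (2 : ℝ) * ((dyadicKernel Ω k F s t : ℝ≥0∞) * dyadicKernel Ω l G s t)
      ∂(lebesgueOn Ω) ≤ 2 * (1 / 4) ^ l * dyadicDensity Ω k F s := by
  calc _ ≤ ∫⁻ t, (2 * (1 / 4) ^ l * (dyadicDensity Ω k F s : ℝ≥0∞)) * dyadicKernel Ω l G s t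
        ∂(lebesgueOn Ω) := by
        refine lintegral_mono fun t => ?_
        -- The scale `k` kernel is replaced by its diagonal value; the scale `l` kernel supplies the
        -- bound on |s-t|² and has mass at most 1. The gain comes from applying this with `l` the
        -- finer scale.
        have h1 : (dyadicKernel Ω k F s t : ℝ≥0∞) ≤ dyadicDensity Ω k F s := by
          by_cases ht : t ∈ dyadicSquare k (dyadicIndex k s) <;> simp [dyadicKernel, ht]
        calc _ = (dyadicKernel Ω k F s t : ℝ≥0∞) *
              (‖s - t‖ₑ ^ (2 : ℝ) * dyadicKernel Ω l G s t) := by ring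
          _ ≤ (dyadicDensity Ω k F s : ℝ≥0∞) * (2 * (1 / 4) ^ l * dyadicKernel Ω l G s t) :=
              mul_le_mul' h1 (enorm_sub_rpow_two_mul_dyadicKernel_le _ _ _ _ _)
          _ = _ := by ring
    _ ≤ _ := by
        rw [lintegral_const_mul _ (measurable_dyadicKernel _ _ _ _).coe_nnreal_ennreal]
        exact (mul_le_mul_right (lintegral_dyadicKernel_le_one _ _ _ _) _).trans_eq (mul_one _)

lemma memLp_dyadicKernel (Ω : Set ℂ) (k : ℕ) (F : Finset (ℤ × ℤ)) (s : ℂ) :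
    MemLp (fun t => ((dyadicKernel Ω k F s t : ℝ) : ℂ)) 2 (lebesgueOn Ω) := by
  refine (memLp_indicator_const 2 (measurableSet_dyadicSquare k (dyadicIndex k s))
    ((dyadicDensity Ω k F s : ℝ) : ℂ)
    (Or.inr (measure_dyadicSquare_lt_top Ω k (dyadicIndex k s)).ne)).ae_eq (.of_forall fun t => ?_)
  by_cases ht : t ∈ dyadicSquare k (dyadicIndex k s) <;> simp [dyadicKernel, ht]

/-! ### Means over several scales -/

/-- Sorting the pairs by their larger index makes the finer scale explicit; the diagonal is counted
twice, whence the inequality. -/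
lemma sq_sum_range_le (x : ℕ → ℝ≥0∞) (M : ℕ) :
    (∑ j ∈ Finset.range M, x j) ^ 2 ≤
      2 * ∑ l ∈ Finset.range M, ∑ j ∈ Finset.range (l + 1), x j * x l := by
  induction M with
  | zero => simp
  | succ M ih =>
    rw [Finset.sum_range_succ (fun l => ∑ j ∈ Finset.range (l + 1), x j * x l),
      Finset.sum_range_succ x, mul_add, ← Finset.sum_mul, Finset.sum_range_succ x]
    calc (∑ j ∈ Finset.range M, x j + x M) ^ 2
        = (∑ j ∈ Finset.range M, x j) ^ 2 + (2 * (∑ j ∈ Finset.range M, x j) * x M + x M ^ 2) := by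
          ring
      _ ≤ (∑ j ∈ Finset.range M, x j) ^ 2 +
          (2 * (∑ j ∈ Finset.range M, x j) * x M + 2 * x M ^ 2) := by
          gcongr
          exact le_mul_of_one_le_left zero_le (by norm_num)
      _ ≤ _ := by
          refine (add_le_add_left ih _).trans (le_of_eq ?_)
          ring

lemma sum_range_four_pow_le (l : ℕ) : ∑ j ∈ Finset.range (l + 1), 4 ^ j ≤ 2 * 4 ^ l := by
  induction l with
  | zero => simp
  | succ l ih =>
    rw [Finset.sum_range_succ, pow_succ]
    omega

/-- The mean of averaging operators at `M` consecutive scales, starting with `2⁻ⁿ`. -/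
noncomputable def multiscaleAvg (Ω : Set ℂ) (M n : ℕ) (F : ℕ → Finset (ℤ × ℤ)) : BL2 Ω :=
  (((M : ℝ≥0)⁻¹ : ℝ) : ℂ) • ∑ j ∈ Finset.range M, dyadicAvg Ω (n + j) (F j)

lemma multiscaleAvg_apply_ae (Ω : Set ℂ) (M n : ℕ) (F : ℕ → Finset (ℤ × ℤ)) (h : L2 Ω) :
    ∀ᵐ s ∂(lebesgueOn Ω), multiscaleAvg Ω M n F h s =
      ∫ t, ((((M : ℝ≥0)⁻¹ * ∑ j ∈ Finset.range M, dyadicKernel Ω (n + j) (F j) s t : ℝ≥0) : ℝ) : ℂ)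
        * h t ∂(lebesgueOn Ω) := by
  have e : multiscaleAvg Ω M n F h = (((M : ℝ≥0)⁻¹ : ℝ) : ℂ) •
      ∑ j ∈ Finset.range M, dyadicAvg Ω (n + j) (F j) h := by
    simp only [multiscaleAvg, sum_apply, smul_apply]
  have h1 : ∀ᵐ s ∂(lebesgueOn Ω), ∀ j, dyadicAvg Ω (n + j) (F j) h s =
      ∫ t, ((dyadicKernel Ω (n + j) (F j) s t : ℝ) : ℂ) * h t ∂(lebesgueOn Ω) :=
    ae_all_iff.2 fun j => dyadicAvg_apply_ae Ω (n + j) (F j) h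
  rw [e]
  filter_upwards [h1, Lp.coeFn_smul (((M : ℝ≥0)⁻¹ : ℝ) : ℂ)
      (∑ j ∈ Finset.range M, dyadicAvg Ω (n + j) (F j) h),
    Lp.coeFn_finsetSum (Finset.range M) fun j => dyadicAvg Ω (n + j) (F j) h] with s h1 h2 h3
  rw [h2, Pi.smul_apply, h3, Finset.sum_apply]
  simp_rw [h1]
  have hint : ∀ j, Integrable (fun t => ((dyadicKernel Ω (n + j) (F j) s t : ℝ) : ℂ) * h t)
      (lebesgueOn Ω) := fun j => (memLp_dyadicKernel Ω _ _ s).integrable_mul (Lp.memLp h)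
  rw [← integral_finsetSum _ fun j _ => hint j,
    smul_eq_mul, ← integral_const_mul]
  refine integral_congr_ae (.of_forall fun t => ?_)
  push_cast
  rw [mul_assoc, Finset.sum_mul]

/-- For j ≤ l the finer scale gives 2·4^-(n+l) and the coarser one at most c·4^(n+j) squares. The
sum over j is geometric, so each l costs O(c): the double sum grows like M, against the factor M⁻²
of the mean. -/
lemma commL_multiscaleAvg_sq_le (Ω : Set ℂ) (M n : ℕ) {F : ℕ → Finset (ℤ × ℤ)} {c : ℕ}
    (hF : ∀ j, (F j).card ≤ c * 4 ^ (n + j)) :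
    commL (multiscaleAvg Ω M n F) ^ (2 : ℝ) ≤ (((M : ℝ≥0)⁻¹ : ℝ≥0) : ℝ≥0∞) ^ 2 * (8 * c * M) := by
  set μ := lebesgueOn Ω with hμ
  have hmem : ∀ s, MemLp (fun t => ((((M : ℝ≥0)⁻¹ *
      ∑ j ∈ Finset.range M, dyadicKernel Ω (n + j) (F j) s t : ℝ≥0) : ℝ) : ℂ)) 2 μ := by
    intro s
    have h1 := (memLp_finsetSum (Finset.range M)
      fun j _ => memLp_dyadicKernel Ω (n + j) (F j) s).const_mul (((M : ℝ≥0)⁻¹ : ℝ) : ℂ)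
    refine h1.ae_eq (.of_forall fun t => ?_)
    push_cast
    rfl
  refine (commL_sq_le_lintegral hmem (multiscaleAvg_apply_ae Ω M n F)).trans ?_
  have hnorm : ∀ x : ℝ≥0, ‖((x : ℝ) : ℂ)‖ₑ = x := fun x => by
    rw [← ofReal_norm, Complex.norm_real, Real.norm_of_nonneg x.coe_nonneg, ENNReal.ofReal_coe_nnreal]
  simp_rw [hnorm]
  obtain ⟨C, hC⟩ : ∃ C, C = (((M : ℝ≥0)⁻¹ : ℝ≥0) : ℝ≥0∞) ^ 2 := ⟨_, rfl⟩
  set κ : ℕ → ℂ → ℂ → ℝ≥0∞ := fun j s t => dyadicKernel Ω (n + j) (F j) s t with hκ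
  have hκm : ∀ j s, Measurable (κ j s) := fun j s =>
    (measurable_dyadicKernel _ _ _ _).coe_nnreal_ennreal
  have hdm : ∀ s : ℂ, Measurable fun t : ℂ => ‖s - t‖ₑ ^ (2 : ℝ) := fun s => by fun_prop
  have hm : ∀ s j l, Measurable fun t => ‖s - t‖ₑ ^ (2 : ℝ) * (κ j s t * κ l s t) :=
    fun s j l => (hdm s).mul ((hκm j s).mul (hκm l s))
  rw [← hC]
  calc _ ≤ ∫⁻ s, ∫⁻ t, (C * 2) * ∑ l ∈ Finset.range M, ∑ j ∈ Finset.range (l + 1),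
          ‖s - t‖ₑ ^ (2 : ℝ) * (κ j s t * κ l s t) ∂μ ∂μ := by
        refine lintegral_mono fun s => lintegral_mono fun t => ?_
        have h1 := sq_sum_range_le (fun j => κ j s t) M
        rw [ENNReal.coe_mul, ENNReal.mul_rpow_of_nonneg _ _ (by norm_num), ENNReal.ofNNReal_finsetSum,
          ENNReal.rpow_two (((M : ℝ≥0)⁻¹ : ℝ≥0) : ℝ≥0∞),
          ENNReal.rpow_two (∑ _ ∈ _, _), ← hC]
        simp_rw [← Finset.mul_sum]
        change ‖s - t‖ₑ ^ (2 : ℝ) * (C * (∑ j ∈ Finset.range M, κ j s t) ^ 2) ≤ _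
        calc _ = C * ‖s - t‖ₑ ^ (2 : ℝ) * (∑ j ∈ Finset.range M, κ j s t) ^ 2 := by ring
          _ ≤ C * ‖s - t‖ₑ ^ (2 : ℝ) *
              (2 * ∑ l ∈ Finset.range M, ∑ j ∈ Finset.range (l + 1), κ j s t * κ l s t) := by gcongr
          _ = _ := by rw [mul_mul_mul_comm, mul_assoc]
    _ ≤ ∫⁻ s, (C * 2) * ∑ l ∈ Finset.range M, ∑ j ∈ Finset.range (l + 1),
          2 * (1 / 4) ^ (n + l) * (dyadicDensity Ω (n + j) (F j) s : ℝ≥0∞) ∂μ := by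
        refine lintegral_mono fun s => ?_
        rw [lintegral_const_mul _ (Finset.measurable_sum _ fun l _ =>
            Finset.measurable_sum _ fun j _ => hm s j l),
          lintegral_finsetSum _ fun l _ =>
            Finset.measurable_sum _ fun j _ => hm s j l]
        gcongr with l _
        rw [lintegral_finsetSum _ fun j _ => hm s j l]
        gcongr with j _
        exact lintegral_dyadicKernel_mul_le Ω (n + j) (n + l) (F j) (F l) s
    _ ≤ (C * 2) * ∑ l ∈ Finset.range M, ∑ j ∈ Finset.range (l + 1),
          2 * (1 / 4 : ℝ≥0∞) ^ (n + l) * ((c * 4 ^ (n + j) : ℕ) : ℝ≥0∞) := by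
        have hm : ∀ l j, Measurable fun s =>
            2 * (1 / 4) ^ (n + l) * (dyadicDensity Ω (n + j) (F j) s : ℝ≥0∞) := fun l j =>
          (measurable_dyadicDensity _ _ _).coe_nnreal_ennreal.const_mul _
        rw [lintegral_const_mul _ (Finset.measurable_sum _ fun l _ =>
            Finset.measurable_sum _ fun j _ => hm l j),
          lintegral_finsetSum _ fun l _ => Finset.measurable_sum _ fun j _ => hm l j]
        gcongr with l _
        rw [lintegral_finsetSum _ fun j _ => hm l j]
        gcongr with j _
        rw [lintegral_const_mul _ (measurable_dyadicDensity _ _ _).coe_nnreal_ennreal]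
        gcongr
        exact (lintegral_dyadicDensity_le _ _ _).trans (by exact_mod_cast hF j)
    -- The geometric sum over j ≤ l is at most twice its last term, which the factor (1/4)^(n+l)
    -- cancels.
    _ ≤ (C * 2) * ∑ l ∈ Finset.range M, (4 * c : ℝ≥0∞) := by
        gcongr with l _
        have h4 : ((1 : ℝ≥0∞) / 4) ^ (n + l) * 4 ^ (n + l) = 1 := by
          rw [← mul_pow, one_div, ENNReal.inv_mul_cancel (by norm_num) (by norm_num), one_pow]
        have h5 : (∑ j ∈ Finset.range (l + 1), (4 : ℝ≥0∞) ^ j) ≤ 2 * 4 ^ l := by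
          exact_mod_cast sum_range_four_pow_le l
        rw [← Finset.mul_sum]
        push_cast
        simp_rw [pow_add (4 : ℝ≥0∞) n, ← mul_assoc, ← Finset.mul_sum]
        calc _ ≤ 2 * (1 / 4 : ℝ≥0∞) ^ (n + l) * ((c : ℝ≥0∞) * 4 ^ n * (2 * 4 ^ l)) := by gcongr
          _ = 4 * c * ((1 / 4) ^ (n + l) * 4 ^ (n + l)) := by rw [pow_add (4 : ℝ≥0∞)]; ring
          _ = 4 * c := by rw [h4, mul_one]
    _ = C * (8 * c * M) := by
        rw [Finset.sum_const, Finset.card_range, nsmul_eq_mul]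
        ring

/-! ### The approximate unit and its commutator bound -/

/-- The dyadic squares of side `2⁻ᵏ` that tile `[-N, N)²`. -/
noncomputable def dyadicBox (N k : ℕ) : Finset (ℤ × ℤ) :=
  Finset.Ico (-(N * 2 ^ k : ℤ)) (N * 2 ^ k) ×ˢ Finset.Ico (-(N * 2 ^ k : ℤ)) (N * 2 ^ k)

lemma card_dyadicBox (N k : ℕ) : (dyadicBox N k).card = 4 * N ^ 2 * 4 ^ k := by
  have h1 : ((N : ℤ) * 2 ^ k - -(N * 2 ^ k)).toNat = 2 * (N * 2 ^ k) := by
    have : ((N : ℤ) * 2 ^ k - -(N * 2 ^ k)) = ((2 * (N * 2 ^ k) : ℕ) : ℤ) := by push_cast; ring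
    rw [this, Int.toNat_natCast]
  have h2 : (4 : ℕ) ^ k = 2 ^ k * 2 ^ k := by rw [← mul_pow]; norm_num
  rw [dyadicBox, Finset.card_product, Int.card_Ico, h1, h2]
  ring

lemma dyadicIndex_mem_dyadicBox {N : ℕ} (k : ℕ) {s : ℂ} (hs : ‖s‖ < N) :
    dyadicIndex k s ∈ dyadicBox N k := by
  have key : ∀ x : ℝ, |x| < N → ⌊2 ^ k * x⌋ ∈ Finset.Ico (-(N * 2 ^ k : ℤ)) (N * 2 ^ k) := by
    intro x hx
    obtain ⟨h1, h2⟩ := abs_lt.1 hx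
    have hp : (0 : ℝ) < 2 ^ k := by positivity
    rw [Finset.mem_Ico, Int.le_floor, Int.floor_lt]
    push_cast
    constructor <;> nlinarith
  exact Finset.mem_product.2 ⟨key _ ((Complex.abs_re_le_norm s).trans_lt hs),
    key _ ((Complex.abs_im_le_norm s).trans_lt hs)⟩

/-- The operators of a bounded approximate unit of `𝒦Λ(Ω)`. -/
noncomputable def approxUnit (Ω : Set ℂ) (N : ℕ) : BL2 Ω :=
  -- N² scales offset the N² in the number of squares of the box; starting at scale 2⁻ᴺ makes the
  -- mesh tend to 0.
  multiscaleAvg Ω (N ^ 2) N fun j => dyadicBox N (N + j)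

/-- With c = 4N² and M = N² the bound 8cM/M² is 32. The square root is then estimated crudely by 32
itself. -/
lemma commL_approxUnit_le (Ω : Set ℂ) (N : ℕ) : commL (approxUnit Ω N) ≤ 32 := by
  have h := commL_multiscaleAvg_sq_le Ω (N ^ 2) N (F := fun j => dyadicBox N (N + j))
    (c := 4 * N ^ 2) fun j => (card_dyadicBox N (N + j)).le
  have h2 : ((((N ^ 2 : ℕ) : ℝ≥0)⁻¹ : ℝ≥0) : ℝ≥0∞) ^ 2 *
      (8 * ((4 * N ^ 2 : ℕ) : ℝ≥0∞) * ((N ^ 2 : ℕ) : ℝ≥0∞)) ≤ 32 := by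
    have h3 : (((N ^ 2 : ℕ) : ℝ≥0)⁻¹) ^ 2 * (8 * (4 * N ^ 2 : ℕ) * (N ^ 2 : ℕ)) ≤ 32 := by
      rcases eq_or_ne N 0 with rfl | hN
      · simp
      · have : (N : ℝ≥0) ≠ 0 := by exact_mod_cast hN
        push_cast
        refine le_of_eq ?_
        field_simp
        norm_num
    exact_mod_cast h3
  have h4 := ENNReal.rpow_le_rpow (h.trans h2) (by norm_num : (0 : ℝ) ≤ 1 / 2)
  rw [← ENNReal.rpow_mul, one_div, mul_inv_cancel₀ (by norm_num), ENNReal.rpow_one] at h4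
  refine h4.trans ?_
  calc (32 : ℝ≥0∞) ^ (2⁻¹ : ℝ) ≤ 32 ^ (1 : ℝ) :=
        ENNReal.rpow_le_rpow_of_exponent_le (by norm_num) (by norm_num)
    _ = 32 := ENNReal.rpow_one _

lemma isCompactOperator_approxUnit (Ω : Set ℂ) (N : ℕ) : IsCompactOperator (approxUnit Ω N) :=
  Submodule.smul_mem (compactOperator (RingHom.id ℂ) (L2 Ω) (L2 Ω)) _
    (Submodule.sum_mem _ fun _ _ => isCompactOperator_dyadicAvg _ _ _)

/-- Balls are convex. The centre `v = 0` gives contractivity of the mean, `v = h` its strong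
convergence. -/
lemma norm_multiscaleAvg_sub_le {Ω : Set ℂ} {M n : ℕ} (hM : M ≠ 0) {F : ℕ → Finset (ℤ × ℤ)}
    {h : L2 Ω} {v : L2 Ω} {ε : ℝ} (hε : ∀ j, ‖dyadicAvg Ω (n + j) (F j) h - v‖ ≤ ε) :
    ‖multiscaleAvg Ω M n F h - v‖ ≤ ε := by
  have hM' : (M : ℂ) ≠ 0 := by exact_mod_cast hM
  have e : multiscaleAvg Ω M n F h - v =
      (M : ℂ)⁻¹ • ∑ j ∈ Finset.range M, (dyadicAvg Ω (n + j) (F j) h - v) := by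
    simp only [multiscaleAvg, sum_apply, smul_apply, Finset.sum_sub_distrib, smul_sub,
      Finset.sum_const, Finset.card_range]
    congr 1
    · push_cast; rfl
    · rw [← Nat.cast_smul_eq_nsmul ℂ, smul_smul, inv_mul_cancel₀ hM', one_smul]
  rw [e, norm_smul, norm_inv, Complex.norm_natCast]
  have h1 := norm_sum_le_of_le (Finset.range M) fun j _ => hε j
  rw [Finset.sum_const, Finset.card_range, nsmul_eq_mul] at h1
  have hpos : (0 : ℝ) < M := by exact_mod_cast Nat.pos_of_ne_zero hM
  rw [inv_mul_le_iff₀ hpos]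
  exact h1

lemma norm_approxUnit_apply_le (Ω : Set ℂ) (N : ℕ) (h : L2 Ω) : ‖approxUnit Ω N h‖ ≤ ‖h‖ := by
  rcases eq_or_ne (N ^ 2) 0 with hN | hN
  · simp [approxUnit, multiscaleAvg, hN]
  · have := norm_multiscaleAvg_sub_le (v := 0) (n := N) (F := fun j => dyadicBox N (N + j)) hN
      (h := h) (ε := ‖h‖) fun j => by
        rw [sub_zero]
        exact norm_dyadicAvg_apply_le _ _ _ _
    rwa [sub_zero] at this

/-! ### Strong convergence to the identity -/

/-- The corner of the dyadic square of side `2⁻ᵏ` with index `i`. -/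
noncomputable def dyadicCorner (k : ℕ) (i : ℤ × ℤ) : ℂ := ⟨i.1 / 2 ^ k, i.2 / 2 ^ k⟩

lemma dyadicIndex_dyadicCorner (k : ℕ) (i : ℤ × ℤ) : dyadicIndex k (dyadicCorner k i) = i := by
  have h : ∀ n : ℤ, (2 : ℝ) ^ k * (n / 2 ^ k) = n := fun n => by field_simp
  simp [dyadicIndex, dyadicCorner, h]

/-- The projections fix step functions on the box, which approximate a uniformly continuous g of
compact support, and contractivity carries this to h. The threshold is uniform in k ≥ N, as a mean
over many scales requires. -/
lemma exists_norm_dyadicAvg_sub_le {Ω : Set ℂ} (h : L2 Ω) {ε : ℝ} (hε : 0 < ε) :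
    ∃ N₀ : ℕ, ∀ N ≥ N₀, ∀ k ≥ N, ‖dyadicAvg Ω k (dyadicBox N k) h - h‖ ≤ ε := by
  obtain ⟨g, hg, hgs, hgc, hd⟩ := exists_continuous_toLp_dist_lt h (show 0 < ε / 4 by positivity)
  obtain ⟨R, hR⟩ := hgs.isCompact.isBounded.subset_closedBall (0 : ℂ)
  have hg0 : ∀ s, R < ‖s‖ → g s = 0 := fun s hs => image_eq_zero_of_notMem_tsupport fun hmem => by
    have := hR hmem
    rw [mem_closedBall_zero_iff] at this
    linarith
  -- A corner lies within distance 2 of every point of its square, so outside radius R + 2 both g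
  -- and its step approximation vanish.
  have hball : lebesgueOn Ω (Metric.ball 0 (R + 2)) ≠ ∞ :=
    ((Measure.restrict_apply_le _ _).trans_lt measure_ball_lt_top).ne
  set V : ℝ := (lebesgueOn Ω).real (Metric.ball 0 (R + 2)) ^ (1 / (2 : ℝ≥0∞).toReal) with hV
  have hV0 : 0 ≤ V := by positivity
  set η : ℝ := ε / (4 * (V + 1)) with hη
  have hη0 : 0 < η := by positivity
  have hηV : η * V ≤ ε / 4 := by
    rw [hη, div_mul_eq_mul_div, div_le_div_iff₀ (by positivity) (by norm_num)]
    nlinarith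
  obtain ⟨δ, hδ, hgδ⟩ := Metric.uniformContinuous_iff.1
    (hgs.uniformContinuous_of_continuous hgc) η hη0
  obtain ⟨n, hn⟩ := exists_pow_lt_of_lt_one (show 0 < δ ^ 2 / 2 by positivity)
    (show (1 / 4 : ℝ) < 1 by norm_num)
  obtain ⟨m, hm⟩ := exists_nat_ge (R + 2)
  refine ⟨max m n, fun N hN k hk => ?_⟩
  have hmN : (m : ℝ) ≤ N := by exact_mod_cast (le_max_left m n).trans hN
  have hnk : n ≤ k := (le_max_right m n).trans (hN.trans hk)
  set v : L2 Ω := ∑ i ∈ dyadicBox N k, g (dyadicCorner k i) • dyadicVec Ω k i with hv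
  have hPv : dyadicAvg Ω k (dyadicBox N k) v = v := by
    rw [hv, map_sum]
    exact Finset.sum_congr rfl fun i hi => by rw [map_smul, dyadicAvg_dyadicVec Ω k hi]
  have hgv : ‖hg.toLp g - v‖ ≤ ε / 4 := by
    have h1 : ‖hg.toLp g - v‖ ≤ ‖indicatorConstLp 2 (Metric.isOpen_ball.measurableSet) hball
        (η : ℂ)‖ := by
      refine Lp.norm_le_norm_of_ae_le ?_
      filter_upwards [Lp.coeFn_sub (hg.toLp g) v, hg.coeFn_toLp, sum_smul_dyadicVec_ae Ω k
        (dyadicBox N k) (fun i => g (dyadicCorner k i)), indicatorConstLp_coeFn (p := 2)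
        (hs := Metric.isOpen_ball.measurableSet) (hμs := hball) (c := (η : ℂ))] with s h1 h2 h3 h4
      rw [h1, Pi.sub_apply, h2, h3, h4, Finset.sum_ite_eq]
      have hc := norm_sub_sq_le_of_dyadicIndex_eq
        (dyadicIndex_dyadicCorner k (dyadicIndex k s))
      set z := dyadicCorner k (dyadicIndex k s)
      have hk1 : (1 / 4 : ℝ) ^ k ≤ 1 := pow_le_one₀ (by norm_num) (by norm_num)
      have hk2 : (1 / 4 : ℝ) ^ k ≤ (1 / 4) ^ n := pow_le_pow_of_le_one (by norm_num)
        (by norm_num) hnk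
      have hzδ : ‖z - s‖ < δ := by nlinarith [norm_nonneg (z - s)]
      have hz2 : ‖z - s‖ < 2 := by nlinarith [norm_nonneg (z - s)]
      by_cases hs : s ∈ Metric.ball (0 : ℂ) (R + 2)
      · rw [Set.indicator_of_mem hs]
        rw [mem_ball_zero_iff] at hs
        rw [if_pos (dyadicIndex_mem_dyadicBox k (by linarith)), Complex.norm_real,
          Real.norm_of_nonneg hη0.le, ← dist_eq_norm, dist_comm]
        exact (hgδ (by rwa [dist_eq_norm])).le
      · rw [Set.indicator_of_notMem hs]
        rw [mem_ball_zero_iff, not_lt] at hs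
        have h5 : ‖s‖ ≤ ‖z‖ + ‖z - s‖ := by
          have := norm_sub_norm_le s (s - z)
          rw [sub_sub_cancel, norm_sub_rev] at this
          linarith
        rw [hg0 s (by linarith), hg0 z (by linarith)]
        simp
    refine h1.trans (norm_indicatorConstLp_le.trans ?_)
    rwa [Complex.norm_real, Real.norm_of_nonneg hη0.le]
  have hhv : ‖h - v‖ ≤ ε / 2 := by
    rw [dist_eq_norm] at hd
    have := norm_add_le (h - hg.toLp g) (hg.toLp g - v)
    rw [sub_add_sub_cancel] at this
    linarith
  -- As Pv = v, the error Ph - h depends only on h - v.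
  have e : dyadicAvg Ω k (dyadicBox N k) h - h =
      dyadicAvg Ω k (dyadicBox N k) (h - v) - (h - v) := by
    rw [map_sub, hPv]
    abel
  rw [e]
  have h1 := norm_sub_le (dyadicAvg Ω k (dyadicBox N k) (h - v)) (h - v)
  have h2 := norm_dyadicAvg_apply_le Ω k (dyadicBox N k) (h - v)
  linarith

open Filter Topology in
lemma tendsto_approxUnit_apply {Ω : Set ℂ} (h : L2 Ω) :
    Tendsto (fun N => approxUnit Ω N h) atTop (𝓝 h) := by
  refine Metric.tendsto_atTop'.2 fun ε hε => ?_
  obtain ⟨N₀, hN₀⟩ := exists_norm_dyadicAvg_sub_le h (half_pos hε)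
  refine ⟨N₀, fun N hN => ?_⟩
  rw [dist_eq_norm]
  -- Here N₀ < N strictly, so N ≠ 0 and the mean is not empty.
  refine (norm_multiscaleAvg_sub_le (pow_ne_zero 2 (by omega)) fun j => ?_).trans_lt
    (half_lt_self hε)
  exact hN₀ N hN.le (N + j) (by omega)

/-! ### Double centralizers of 𝒦Λ(Ω) -/

namespace KLambda

variable {Ω : Set ℂ}

/-- The bounded approximate unit, as elements of `𝒦Λ(Ω)`. -/
noncomputable def approxUnit (Ω : Set ℂ) (N : ℕ) : KLambda Ω :=
  ⟨_root_.approxUnit Ω N, (commL_approxUnit_le Ω N).trans_lt (by norm_num),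
    isCompactOperator_approxUnit Ω N⟩

lemma norm_approxUnit_le (N : ℕ) : ‖approxUnit Ω N‖ ≤ 33 := by
  have h1 : ‖(approxUnit Ω N).toOp‖ ≤ 1 :=
    ContinuousLinearMap.opNorm_le_bound _ zero_le_one fun h => by
      rw [one_mul]
      exact norm_approxUnit_apply_le Ω N h
  have h2 : (commL (approxUnit Ω N).toOp).toReal ≤ 32 :=
    ENNReal.toReal_le_of_le_ofReal (by norm_num)
      ((commL_approxUnit_le Ω N).trans_eq (by norm_num))
  rw [norm_def]
  linarith

lemma norm_toOp_le (x : KLambda Ω) : ‖x.toOp‖ ≤ ‖x‖ := by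
  rw [norm_def]
  linarith [ENNReal.toReal_nonneg (a := commL x.toOp)]

lemma commL_toOp_le (x : KLambda Ω) : commL x.toOp ≤ ENNReal.ofReal ‖x‖ := by
  refine (ENNReal.le_ofReal_iff_toReal_le x.commL_ne_top (norm_nonneg x)).2 ?_
  change _ ≤ ‖x.toOp‖ + _
  linarith [norm_nonneg x.toOp]

open Filter Topology in
/-- `𝒦Λ(Ω)` separates bounded operators. -/
lemma op_ext {S T : BL2 Ω} (h : ∀ x : KLambda Ω, S * x.toOp = T * x.toOp) : S = T := by
  ext1 v
  have hS : Tendsto (fun N => S (_root_.approxUnit Ω N v)) atTop (𝓝 (S v)) :=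
    (S.continuous.tendsto _).comp (tendsto_approxUnit_apply v)
  have hT : Tendsto (fun N => T (_root_.approxUnit Ω N v)) atTop (𝓝 (T v)) :=
    (T.continuous.tendsto _).comp (tendsto_approxUnit_apply v)
  refine tendsto_nhds_unique hS (hT.congr fun N => ?_)
  exact (DFunLike.congr_fun (h (approxUnit Ω N)) v).symm

/-- The linear map `g ↦ T'(⟨g, ·⟩ e)* e`. -/
noncomputable def adjointOrbit (T' : KLambda Ω →L[ℂ] KLambda Ω) (e : coordDomain Ω) :
    coordDomain Ω →ₗ[ℂ] L2 Ω where
  toFun g := ContinuousLinearMap.adjoint (T' (rankOne e g)).toOp e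
  map_add' g h := by
    have : rankOne e (g + h) = rankOne e g + rankOne e h := toOp_injective <| by
      ext1 v
      rw [toOp_add, add_apply]
      simp only [toOp_rankOne_apply, Submodule.coe_add, inner_add_left, add_smul]
    rw [this, map_add, toOp_add, map_add, add_apply]
  -- The rank one operator is conjugate-linear in `g` and so is the adjoint; the composite is
  -- linear.
  map_smul' c g := by
    have : rankOne e (c • g) = (starRingEnd ℂ) c • rankOne e g := toOp_injective <| by
      ext1 v
      rw [toOp_smul, smul_apply]
      simp only [toOp_rankOne_apply, Submodule.coe_smul, inner_smul_left, mul_smul]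
    rw [this, map_smul, toOp_smul, map_smulₛₗ, smul_apply, RingHom.id_apply, Complex.conj_conj]

/-- The centralizer identity for x = ⟨g,·⟩e, paired with the unit vector e. It says that the adjoint
of g ↦ w, once bounded, implements `T''`. -/
lemma inner_adjointOrbit {T' T'' : KLambda Ω →L[ℂ] KLambda Ω}
    (hc : ∀ x y : KLambda Ω, T' x * y = x * T'' y) {e : coordDomain Ω} (he : ‖(e : L2 Ω)‖ = 1)
    (g : coordDomain Ω) (y : KLambda Ω) (h : L2 Ω) :
    inner ℂ (adjointOrbit T' e g) (y.toOp h) = inner ℂ (g : L2 Ω) ((T'' y).toOp h) := by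
  have h1 : (T' (rankOne e g)).toOp (y.toOp h) =
      inner ℂ (g : L2 Ω) ((T'' y).toOp h) • (e : L2 Ω) :=
    DFunLike.congr_fun (congrArg toOp (hc (rankOne e g) y)) h
  change inner ℂ (ContinuousLinearMap.adjoint (T' (rankOne e g)).toOp (e : L2 Ω)) _ = _
  rw [ContinuousLinearMap.adjoint_inner_left, h1, inner_smul_right, inner_self_eq_norm_sq_to_K, he]
  simp

open Filter Topology in
-- Testing w against u_N w bounds ⟨w, u_N w⟩ by means of T''(u_N) uniformly in N, and ⟨w, u_N w⟩ →
-- ‖w‖².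
lemma norm_adjointOrbit_le {T' T'' : KLambda Ω →L[ℂ] KLambda Ω}
    (hc : ∀ x y : KLambda Ω, T' x * y = x * T'' y) {e : coordDomain Ω} (he : ‖(e : L2 Ω)‖ = 1)
    (g : coordDomain Ω) : ‖adjointOrbit T' e g‖ ≤ (‖T''‖ * 33) * ‖(g : L2 Ω)‖ := by
  set w := adjointOrbit T' e g with hw
  have h1 : ∀ N, ‖inner ℂ w ((approxUnit Ω N).toOp w)‖ ≤
      (‖T''‖ * 33) * ‖(g : L2 Ω)‖ * ‖w‖ := fun N => by
    rw [hw, inner_adjointOrbit hc he]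
    refine (norm_inner_le_norm _ _).trans ?_
    have h2 : ‖(T'' (approxUnit Ω N)).toOp‖ ≤ ‖T''‖ * 33 :=
      (norm_toOp_le _).trans ((T''.le_opNorm _).trans
        (mul_le_mul_of_nonneg_left (norm_approxUnit_le N) (norm_nonneg _)))
    have h3 := (T'' (approxUnit Ω N)).toOp.le_of_opNorm_le h2 w
    rw [← hw]
    calc _ ≤ ‖(g : L2 Ω)‖ * ((‖T''‖ * 33) * ‖w‖) := by gcongr
      _ = _ := by ring
  have h2 : Tendsto (fun N => ‖inner ℂ w ((approxUnit Ω N).toOp w)‖) atTop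
      (𝓝 ‖inner ℂ w w‖) := (tendsto_const_nhds.inner (tendsto_approxUnit_apply w)).norm
  have h3 := le_of_tendsto' h2 h1
  rw [inner_self_eq_norm_sq_to_K, norm_pow, RCLike.norm_ofReal, abs_norm] at h3
  by_contra! hlt
  have : 0 < ‖w‖ := lt_of_le_of_lt (by positivity) hlt
  nlinarith

/-- Every double centralizer of `𝒦Λ(Ω)` is given by an operator in `EΛ(Ω)`. -/
lemma exists_op_of_central (T' T'' : KLambda Ω →L[ℂ] KLambda Ω)
    (hc : ∀ x y : KLambda Ω, T' x * y = x * T'' y) :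
    ∃ T : ELambda Ω, ∀ x : KLambda Ω,
      (T' x).toOp = x.toOp * (T : BL2 Ω) ∧ (T'' x).toOp = (T : BL2 Ω) * x.toOp := by
  have hd : DenseRange ((coordDomain Ω).subtypeL : coordDomain Ω → L2 Ω) := by
    simpa [DenseRange] using dense_coordDomain Ω
  -- Without a nonzero vector in the dense coordinate domain, L² itself is trivial and T = 0 works.
  by_cases htriv : ∀ e : coordDomain Ω, (e : L2 Ω) = 0
  · have h0 : ∀ v : L2 Ω, v = 0 := fun v => by
      have := congrFun (hd.equalizer continuous_id continuous_zero (funext htriv)) v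
      exact this
    exact ⟨0, fun x => ⟨ContinuousLinearMap.ext fun v => (h0 _).trans (h0 _).symm,
      ContinuousLinearMap.ext fun v => (h0 _).trans (h0 _).symm⟩⟩
  push Not at htriv
  obtain ⟨e₀, he₀⟩ := htriv
  obtain ⟨e, he⟩ : ∃ e : coordDomain Ω, ‖(e : L2 Ω)‖ = 1 :=
    ⟨((‖(e₀ : L2 Ω)‖⁻¹ : ℝ) : ℂ) • e₀, by
      rw [Submodule.coe_smul, norm_smul, Complex.norm_real, norm_inv, norm_norm,
        inv_mul_cancel₀ (norm_ne_zero_iff.2 he₀)]⟩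
  set S : L2 Ω →L[ℂ] L2 Ω := (adjointOrbit T' e).extendOfNorm (coordDomain Ω).subtypeL.toLinearMap
  have hS : ∀ g : coordDomain Ω, S g = adjointOrbit T' e g := fun g =>
    LinearMap.extendOfNorm_eq hd ⟨_, norm_adjointOrbit_le hc he⟩ g
  set T : BL2 Ω := ContinuousLinearMap.adjoint S
  have hT'' : ∀ x : KLambda Ω, (T'' x).toOp = T * x.toOp := fun x => by
    ext1 v
    refine (dense_coordDomain Ω).eq_of_inner_right (𝕜 := ℂ) fun g hg => ?_
    have h1 := inner_adjointOrbit hc he ⟨g, hg⟩ x v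
    rw [← hS] at h1
    rw [← h1]
    exact (ContinuousLinearMap.adjoint_inner_right S _ _).symm
  -- After right multiplication by any y, both sides equal x T''(y).
  have hT' : ∀ x : KLambda Ω, (T' x).toOp = x.toOp * T := fun x => op_ext fun y => by
    rw [mul_assoc, ← hT'', ← toOp_mul, ← toOp_mul, hc]
  have hmem : T ∈ ELambda Ω := by
    have hle : commL T ≤ ENNReal.ofReal (‖T''‖ * 33) := by
      refine commL_le_of_tendsto (Y := fun N => (T'' (approxUnit Ω N)).toOp) (fun v => ?_)
        fun N => ?_
      · simp_rw [hT'']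
        exact (T.continuous.tendsto _).comp (tendsto_approxUnit_apply v)
      · exact (commL_toOp_le _).trans (ENNReal.ofReal_le_ofReal ((T''.le_opNorm _).trans
          (mul_le_mul_of_nonneg_left (norm_approxUnit_le N) (norm_nonneg _))))
    exact hle.trans_lt ENNReal.ofReal_lt_top
  exact ⟨⟨T, hmem⟩, fun x => ⟨hT' x, hT'' x⟩⟩

lemma norm_add_commL_mul_le {S T : BL2 Ω} (hS : commL S ≠ ∞) (hT : commL T ≠ ∞) :
    ‖S * T‖ + (commL (S * T)).toReal ≤
      (‖S‖ + (commL S).toReal) * (‖T‖ + (commL T).toReal) := by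
  have h1 : commL S * ‖T‖ₑ ≠ ∞ := ENNReal.mul_ne_top hS enorm_ne_top
  have h2 : ‖S‖ₑ * commL T ≠ ∞ := ENNReal.mul_ne_top enorm_ne_top hT
  have h3 := ENNReal.toReal_mono (ENNReal.add_ne_top.2 ⟨h1, h2⟩) (commL_mul_le S T)
  rw [ENNReal.toReal_add h1 h2, ENNReal.toReal_mul, ENNReal.toReal_mul, toReal_enorm,
    toReal_enorm] at h3
  have h4 := norm_mul_le S T
  have h5 : 0 ≤ (commL S).toReal * (commL T).toReal :=
    mul_nonneg ENNReal.toReal_nonneg ENNReal.toReal_nonneg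
  nlinarith

/-- Multiplication by `T ∈ EΛ(Ω)` from the left on `𝒦Λ(Ω)`. -/
noncomputable def mulLeft (T : ELambda Ω) : KLambda Ω →L[ℂ] KLambda Ω :=
  LinearMap.mkContinuous
    { toFun := fun x => ⟨(T : BL2 Ω) * x.toOp, mul_mem T.2 x.toOp_mem, x.toOp_compact.clm_comp _⟩
      map_add' := fun _ _ => toOp_injective (mul_add _ _ _)
      map_smul' := fun _ _ => toOp_injective (mul_smul_comm _ _ _) }
    (‖(T : BL2 Ω)‖ + (commL (T : BL2 Ω)).toReal)
    fun x => norm_add_commL_mul_le (LT.lt.ne T.2) x.commL_ne_top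

/-- Multiplication by `T ∈ EΛ(Ω)` from the right on `𝒦Λ(Ω)`. -/
noncomputable def mulRight (T : ELambda Ω) : KLambda Ω →L[ℂ] KLambda Ω :=
  LinearMap.mkContinuous
    { toFun := fun x => ⟨x.toOp * (T : BL2 Ω), mul_mem x.toOp_mem T.2, x.toOp_compact.comp_clm _⟩
      map_add' := fun _ _ => toOp_injective (add_mul _ _ _)
      map_smul' := fun _ _ => toOp_injective (smul_mul_assoc _ _ _) }
    (‖(T : BL2 Ω)‖ + (commL (T : BL2 Ω)).toReal)
    fun x => (norm_add_commL_mul_le x.commL_ne_top (LT.lt.ne T.2)).trans_eq (mul_comm _ _)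

lemma doubleCentralizer_ext {a b : 𝓜(ℂ, KLambda Ω)}
    (h₁ : ∀ x, (a.fst x).toOp = (b.fst x).toOp) (h₂ : ∀ x, (a.snd x).toOp = (b.snd x).toOp) :
    a = b :=
  DoubleCentralizer.ext _ _ _ _ (Prod.ext (ContinuousLinearMap.ext fun x => toOp_injective (h₁ x))
    (ContinuousLinearMap.ext fun x => toOp_injective (h₂ x)))

/-- The action of `EΛ(Ω)` on its ideal `𝒦Λ(Ω)` by double centralizers. -/
noncomputable def toDoubleCentralizer (Ω : Set ℂ) : ELambda Ω →ₐ[ℂ] 𝓜(ℂ, KLambda Ω) where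
  -- `DoubleCentralizer` lists the left action first: `fst` plays the role of T'' and `snd` that of
  -- T'.
  toFun T := ⟨(mulLeft T, mulRight T), fun _ _ => toOp_injective (mul_assoc _ _ _)⟩
  map_one' := doubleCentralizer_ext (fun _ => one_mul _) fun _ => mul_one _
  map_mul' _ _ := doubleCentralizer_ext (fun _ => mul_assoc _ _ _) fun _ => (mul_assoc _ _ _).symm
  map_zero' := doubleCentralizer_ext (fun _ => zero_mul _) fun _ => mul_zero _
  map_add' _ _ := doubleCentralizer_ext (fun _ => add_mul _ _ _) fun _ => mul_add _ _ _
  commutes' c := doubleCentralizer_ext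
    (fun x => by
      rw [DoubleCentralizer.algebraMap_fst]
      exact (Algebra.smul_def c x.toOp).symm)
    fun x => by
      rw [DoubleCentralizer.algebraMap_snd]
      exact (Algebra.commutes c x.toOp).symm.trans (Algebra.smul_def c x.toOp).symm

lemma bijective_toDoubleCentralizer (Ω : Set ℂ) :
    Function.Bijective (toDoubleCentralizer Ω) := by
  refine ⟨fun S T h => Subtype.ext (op_ext fun x => ?_), fun a => ?_⟩
  · exact congrArg (fun a : 𝓜(ℂ, KLambda Ω) => (a.fst x).toOp) h
  · obtain ⟨T, hT⟩ := exists_op_of_central a.snd a.fst a.central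
    exact ⟨T, doubleCentralizer_ext (fun x => (hT x).2.symm) fun x => (hT x).1.symm⟩

end KLambda

theorem mainTheorem7 (Ω : Set ℂ) (hΩ : MeasurableSet Ω) :
    (∃ Φ : ELambda Ω ≃ₐ[ℂ] 𝓜(ℂ, KLambda Ω), ∀ (T : ELambda Ω) (x : KLambda Ω),
      ((Φ T).snd x).toOp = x.toOp * (T : BL2 Ω) ∧ ((Φ T).fst x).toOp = (T : BL2 Ω) * x.toOp) ∧
    ∀ T' T'' : KLambda Ω →L[ℂ] KLambda Ω, (∀ x y : KLambda Ω, T' x * y = x * T'' y) →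
      ∃! T : ELambda Ω, ∀ x : KLambda Ω,
        (T' x).toOp = x.toOp * (T : BL2 Ω) ∧ (T'' x).toOp = (T : BL2 Ω) * x.toOp := by
  refine ⟨⟨AlgEquiv.ofBijective (KLambda.toDoubleCentralizer Ω)
    (KLambda.bijective_toDoubleCentralizer Ω), fun T x => ⟨rfl, rfl⟩⟩, fun T' T'' hc => ?_⟩
  obtain ⟨T, hT⟩ := KLambda.exists_op_of_central T' T'' hc
  exact ⟨T, hT, fun S hS => Subtype.ext (KLambda.op_ext fun x =>
    (hS x).2.symm.trans (hT x).2)⟩
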